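/- For $a\in\mathbb R$ let $e_a(t)=e^{iat}\in L^2(-\pi,\pi)$. A system of vectors in a Hilbert space is complete if its linear span is dense, minimal if none of its members lies in the closed linear span of the others, and a Riesz basis if it is the image of an orthonormal basis under a bounded invertible operator. The generating function of a set $Z\subset\mathbb R$ for which $\{e_\zeta\}_{\zeta\in Z}$ is complete and minimal is $$F(z)=\lim_{R\to\infty}\ \prod_{\zeta\in Z,\ |\zeta|<R}\Bigl(1-\frac z\zeta\Bigr),\qquad z\in\mathbb C,$$ where the factor with $\zeta=0$, if $0\in Z$, is read as $z$. **Theorem 4.1.** Let $\Lambda\subset\mathbb R$ be such that $\{e_\lambda\}_{\lambda\in\Lambda}$ is complete and minimal in $L^2(-\pi,\pi)$, let $\{w_\lambda\}_{\lambda\in\Lambda}$ be its biorthogonal system, that is, $\langle e_\lambda,w_\mu\rangle=\delta_{\lambda\mu}$ for $\lambda,\mu\in\Lambda$, and let $\Lambda_1\subset\Lambda$. (1) Suppose that there is a set $\tilde\Lambda_2\subset\mathbb R$ such that $\{e_\zeta\}_{\zeta\in\Lambda_1\cup\tilde\Lambda_2}$ is a Riesz basis of $L^2(-\pi,\pi)$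 and such that the generating function $F$ of $\Lambda_1\cup\tilde\Lambda_2$ satisfies, for some constant $C$, $|F'(\zeta)|\le C$ at all zeros $\zeta$ of $F$. Then the mixed system $$\{e_\lambda\}_{\lambda\in\Lambda_1}\cup\{w_\lambda\}_{\lambda\in\Lambda\setminus\Lambda_1}$$ is complete in $L^2(-\pi,\pi)$. (2) In particular, if this mixed system is not complete, then $\Lambda_1\not\subset\mathbb Z$. -/

import Mathlib

open MeasureTheory Filter Topology

/-- The Hilbert space `L²(-π, π)` of complex-valued functions. -/
abbrev L2pi : Type := Lp ℂ 2 (volume.restrict (Set.Ioo (-Real.pi) Real.pi))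

theorem memLp_exponential (a : ℝ) :
    MemLp (fun t : ℝ => Complex.exp (Complex.I * a * t)) 2
      (volume.restrict (Set.Ioo (-Real.pi) Real.pi)) := by
  refine MemLp.of_bound (by fun_prop) 1 (Eventually.of_forall fun t => ?_)
  have h : Complex.I * (a : ℂ) * (t : ℂ) = ((a * t : ℝ) : ℂ) * Complex.I := by
    push_cast; ring
  rw [h, Complex.norm_exp_ofReal_mul_I]

/-- The exponential `t ↦ e^{iat}` as an element of `L²(-π, π)`. -/
noncomputable def exponential (a : ℝ) : L2pi := (memLp_exponential a).toLp _

section Systems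

variable {H : Type*} [NormedAddCommGroup H] [InnerProductSpace ℂ H]

/-- A set of vectors is complete if its linear span is dense. -/
def IsCompleteSystem (S : Set H) : Prop :=
  (Submodule.span ℂ S).topologicalClosure = ⊤

/-- A family is minimal if no member lies in the closed linear span of the others. -/
def IsMinimalSystem {ι : Type*} (v : ι → H) : Prop :=
  ∀ i, v i ∉ (Submodule.span ℂ (v '' {j | j ≠ i})).topologicalClosure

/-- A Riesz basis: the image of an orthonormal basis under a bounded invertible operator. -/
def IsRieszBasis {ι : Type*} (v : ι → H) : Prop :=
  ∃ (b : HilbertBasis ι ℂ H) (T : H ≃L[ℂ] H), ∀ i, v i = T (b i)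

end Systems

/-- The family `w` (only its values on `Λ` matter) is biorthogonal to the exponentials with
frequencies in `Λ`. -/
def IsBiorthogonalTo (Λ : Set ℝ) (w : ℝ → L2pi) : Prop :=
  (∀ a ∈ Λ, inner ℂ (exponential a) (w a) = 1) ∧
    ∀ a ∈ Λ, ∀ b ∈ Λ, a ≠ b → inner ℂ (exponential a) (w b) = 0

/-- The mixed system: exponentials with frequencies in `Λ₁`, and the members of the
biorthogonal family with indices in `Λ \ Λ₁`. -/
def mixedSystem (Λ Λ₁ : Set ℝ) (w : ℝ → L2pi) : Set L2pi :=
  exponential '' Λ₁ ∪ w '' (Λ \ Λ₁)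

open Classical in
/-- The factor of the canonical product that vanishes at `a`: it is `1 - z / a`, or `z`
if `a = 0`. -/
noncomputable def canonicalFactor (a : ℝ) (z : ℂ) : ℂ :=
  if a = 0 then z else 1 - z / a

/-- `F` is the generating function of `Λ`: the principal value
`lim_{R → ∞} ∏_{a ∈ Λ, |a| < R} (1 - z / a)`. The first clause says that the partial
products are finite products. -/
def IsGeneratingFunction (Λ : Set ℝ) (F : ℂ → ℂ) : Prop :=
  (∀ R : ℝ, {a ∈ Λ | |a| < R}.Finite) ∧
    ∀ z : ℂ, Tendsto (fun R : ℝ => ∏ᶠ a ∈ {a ∈ Λ | |a| < R}, canonicalFactor a z)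
      atTop (𝓝 (F z))

theorem memLp_cexp (z : ℂ) :
    MemLp (fun t : ℝ => Complex.exp (Complex.I * z * t)) 2
      (volume.restrict (Set.Ioo (-Real.pi) Real.pi)) := by
  refine MemLp.of_bound (by fun_prop) (Real.exp (‖z‖ * Real.pi)) ?_
  filter_upwards [ae_restrict_mem measurableSet_Ioo] with t ht
  rw [Complex.norm_exp]
  refine Real.exp_le_exp.2 ((Complex.re_le_norm _).trans ?_)
  rw [norm_mul, norm_mul, Complex.norm_I, one_mul, Complex.norm_real]
  exact mul_le_mul_of_nonneg_left (abs_le.2 ⟨ht.1.le, ht.2.le⟩) (norm_nonneg _)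

/-- The function `t ↦ e^{izt}` as an element of `L²(-π, π)`, for complex `z`. -/
noncomputable def cexponential (z : ℂ) : L2pi := (memLp_cexp z).toLp _

theorem cexponential_ofReal (a : ℝ) : cexponential a = exponential a := rfl

theorem coeFn_cexponential (z : ℂ) :
    cexponential z =ᵐ[volume.restrict (Set.Ioo (-Real.pi) Real.pi)]
      fun t : ℝ => Complex.exp (Complex.I * z * t) := MemLp.coeFn_toLp _

/-- The Fourier transform of a function in `L²(-π, π)`, an entire function. -/
noncomputable def fourierEntire (φ : L2pi) (z : ℂ) : ℂ :=
  inner ℂ (cexponential (starRingEnd ℂ z)) φ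

theorem fourierEntire_ofReal (φ : L2pi) (x : ℝ) :
    fourierEntire φ x = inner ℂ (exponential x) φ := by
  rw [fourierEntire, Complex.conj_ofReal, cexponential_ofReal]

theorem fourierEntire_eq_integral (φ : L2pi) (z : ℂ) :
    fourierEntire φ z = ∫ t in Set.Ioo (-Real.pi) Real.pi,
      Complex.exp (-(Complex.I * z * t)) * φ t := by
  rw [fourierEntire, L2.inner_def]
  refine integral_congr_ae ?_
  filter_upwards [coeFn_cexponential (starRingEnd ℂ z)] with t ht
  rw [ht, RCLike.inner_apply', ← Complex.exp_conj]
  simp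

theorem fourierEntire_add (φ ψ : L2pi) (z : ℂ) :
    fourierEntire (φ + ψ) z = fourierEntire φ z + fourierEntire ψ z := inner_add_right _ _ _

theorem fourierEntire_smul (c : ℂ) (φ : L2pi) (z : ℂ) :
    fourierEntire (c • φ) z = c * fourierEntire φ z := inner_smul_right _ _ _

theorem L2pi.integrable (φ : L2pi) :
    Integrable φ (volume.restrict (Set.Ioo (-Real.pi) Real.pi)) :=
  (Lp.memLp φ).integrable (by norm_num)

theorem L2pi.norm_sq_eq_integral (φ : L2pi) :
    ‖φ‖ ^ 2 = ∫ t in Set.Ioo (-Real.pi) Real.pi, ‖φ t‖ ^ 2 := by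
  have h1 : inner ℂ φ φ = ((∫ t in Set.Ioo (-Real.pi) Real.pi, ‖φ t‖ ^ 2 : ℝ) : ℂ) := by
    rw [L2.inner_def, ← integral_complex_ofReal]
    refine integral_congr_ae (Eventually.of_forall fun t => ?_)
    simp only
    rw [inner_self_eq_norm_sq_to_K]
    norm_cast
  rw [inner_self_eq_norm_sq_to_K] at h1
  exact Complex.ofReal_injective (by rw [← h1]; norm_cast)

theorem norm_cexp_neg_I_mul_le {z : ℂ} {t : ℝ} (ht : t ∈ Set.Ioo (-Real.pi) Real.pi) :
    ‖Complex.exp (-(Complex.I * z * t))‖ ≤ Real.exp (‖z‖ * Real.pi) := by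
  rw [Complex.norm_exp]
  refine Real.exp_le_exp.2 ((Complex.re_le_norm _).trans ?_)
  rw [norm_neg, norm_mul, norm_mul, Complex.norm_I, one_mul, Complex.norm_real]
  exact mul_le_mul_of_nonneg_left (abs_le.2 ⟨ht.1.le, ht.2.le⟩) (norm_nonneg _)

theorem differentiable_fourierEntire (φ : L2pi) : Differentiable ℂ (fourierEntire φ) := by
  intro z₀
  have hfun : fourierEntire φ = fun z => ∫ t in Set.Ioo (-Real.pi) Real.pi,
      Complex.exp (-(Complex.I * z * t)) * φ t := funext (fourierEntire_eq_integral φ)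
  rw [hfun]
  have hφ := L2pi.integrable φ
  have hint : ∀ z : ℂ, Integrable (fun t : ℝ => Complex.exp (-(Complex.I * z * t)) * φ t)
      (volume.restrict (Set.Ioo (-Real.pi) Real.pi)) := by
    intro z
    refine hφ.bdd_mul (c := Real.exp (‖z‖ * Real.pi)) (by fun_prop) ?_
    filter_upwards [ae_restrict_mem measurableSet_Ioo] with t ht
    exact norm_cexp_neg_I_mul_le ht
  have := hasDerivAt_integral_of_dominated_loc_of_deriv_le
    (μ := volume.restrict (Set.Ioo (-Real.pi) Real.pi)) (s := Metric.ball z₀ 1)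
    (F := fun (z : ℂ) (t : ℝ) => Complex.exp (-(Complex.I * z * t)) * φ t)
    (F' := fun (z : ℂ) (t : ℝ) => Complex.exp (-(Complex.I * z * t)) * (-(Complex.I * t)) * φ t)
    (x₀ := z₀) (bound := fun t => (Real.exp ((‖z₀‖ + 1) * Real.pi) * Real.pi) * ‖φ t‖)
    (Metric.ball_mem_nhds _ one_pos)
    (Eventually.of_forall fun z => (hint z).aestronglyMeasurable) (hint z₀)
    ((by fun_prop : AEStronglyMeasurable (fun t : ℝ =>
      Complex.exp (-(Complex.I * z₀ * t)) * (-(Complex.I * t)))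
        (volume.restrict (Set.Ioo (-Real.pi) Real.pi))).mul hφ.aestronglyMeasurable)
    ?_ (hφ.norm.const_mul _) ?_
  · exact this.2.differentiableAt
  · filter_upwards [ae_restrict_mem measurableSet_Ioo] with t ht z hz
    rw [norm_mul, norm_mul, norm_neg, norm_mul, Complex.norm_I, one_mul, Complex.norm_real]
    refine mul_le_mul_of_nonneg_right (mul_le_mul ((norm_cexp_neg_I_mul_le ht).trans ?_)
      (abs_le.2 ⟨ht.1.le, ht.2.le⟩) (norm_nonneg _) (Real.exp_pos _).le) (norm_nonneg _)
    refine Real.exp_le_exp.2 (mul_le_mul_of_nonneg_right ?_ Real.pi_pos.le)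
    have := norm_le_norm_add_norm_sub' z z₀
    rw [Metric.mem_ball, dist_eq_norm] at hz
    linarith
  · refine Eventually.of_forall fun t z _ => ?_
    have h1 : HasDerivAt (fun z : ℂ => -(Complex.I * z * t)) (-(Complex.I * t)) z := by
      simpa using (((hasDerivAt_id z).const_mul Complex.I).mul_const (t : ℂ)).fun_neg
    exact h1.cexp.mul_const _

/-- Zeros can be divided out: if `φ̂(μ) = 0`, then `φ̂(z) / (z - μ)` is again the Fourier
transform of a function in `L²(-π, π)`. -/
theorem exists_fourierEntire_div (φ : L2pi) (μ : ℝ) (h : fourierEntire φ μ = 0) :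
    ∃ ψ : L2pi, ∀ z : ℂ, (z - μ) * fourierEntire ψ z = fourierEntire φ z := by
  set ν := volume.restrict (Set.Ioo (-Real.pi) Real.pi) with hν
  have hφ := L2pi.integrable φ
  set f : ℝ → ℂ := fun s => Complex.exp (-(Complex.I * μ * s)) * φ s with hf
  have hfi : Integrable f ν := by
    refine hφ.bdd_mul (c := Real.exp (‖(μ : ℂ)‖ * Real.pi)) (by fun_prop) ?_
    filter_upwards [ae_restrict_mem measurableSet_Ioo] with t ht
    exact norm_cexp_neg_I_mul_le ht
  have hf0 : ∫ s, f s ∂ν = 0 := by rw [← h, fourierEntire_eq_integral]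
  set Φ : ℝ → ℂ := fun t => ∫ s, (Set.Iio t).indicator f s ∂ν with hΦ
  have hΦm : AEStronglyMeasurable Φ ν := by
    have : AEStronglyMeasurable (fun p : ℝ × ℝ => {p : ℝ × ℝ | p.2 < p.1}.indicator
        (fun p => f p.2) p) (ν.prod ν) :=
      hfi.aestronglyMeasurable.comp_snd.indicator
        (measurableSet_lt measurable_snd measurable_fst)
    exact this.integral_prod_right'
  have hΦb : ∀ t, ‖Φ t‖ ≤ ∫ s, ‖f s‖ ∂ν := by
    intro t
    refine (norm_integral_le_integral_norm _).trans (integral_mono_of_nonneg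
      (Eventually.of_forall fun _ => norm_nonneg _) hfi.norm (Eventually.of_forall fun s => ?_))
    exact norm_indicator_le_norm_self _ _
  set g : ℝ → ℂ := fun t => Complex.I * Complex.exp (Complex.I * μ * t) * Φ t with hg
  have hgL : MemLp g 2 ν := by
    refine MemLp.of_bound ((by fun_prop : AEStronglyMeasurable (fun t : ℝ =>
      Complex.I * Complex.exp (Complex.I * μ * t)) ν).mul hΦm) (∫ s, ‖f s‖ ∂ν)
      (Eventually.of_forall fun t => ?_)
    have h1 : Complex.I * (μ : ℂ) * (t : ℂ) = ((μ * t : ℝ) : ℂ) * Complex.I := by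
      push_cast; ring
    rw [hg, norm_mul, norm_mul, Complex.norm_I, one_mul, h1, Complex.norm_exp_ofReal_mul_I,
      one_mul]
    exact hΦb t
  refine ⟨hgL.toLp g, fun z => ?_⟩
  rcases eq_or_ne z μ with rfl | hz
  · rw [sub_self, zero_mul, h]
  have hz' : Complex.I * (μ - z) ≠ 0 := mul_ne_zero Complex.I_ne_zero (sub_ne_zero.2 hz.symm)
  set e : ℝ → ℂ := fun t => Complex.exp (Complex.I * (μ - z) * t) with he
  have he_int : ∀ s ∈ Set.Ioo (-Real.pi) Real.pi,
      ∫ t, (Set.Ioi s).indicator e t ∂ν = (e Real.pi - e s) / (Complex.I * (μ - z)) := by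
    intro s hs
    rw [integral_indicator measurableSet_Ioi, hν, Measure.restrict_restrict measurableSet_Ioi,
      show Set.Ioi s ∩ Set.Ioo (-Real.pi) Real.pi = Set.Ioo s Real.pi by
        ext t; simp only [Set.mem_inter_iff, Set.mem_Ioi, Set.mem_Ioo]
        exact ⟨fun h => ⟨h.1, h.2.2⟩, fun h => ⟨h.1, hs.1.trans h.1, h.2⟩⟩,
      ← integral_Ioc_eq_integral_Ioo, ← intervalIntegral.integral_of_le hs.2.le,
      integral_exp_mul_complex hz']
  have h1 : fourierEntire (hgL.toLp g) z = ∫ t, Complex.I * (e t * Φ t) ∂ν := by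
    rw [fourierEntire_eq_integral]
    refine integral_congr_ae ?_
    filter_upwards [hgL.coeFn_toLp] with t ht
    rw [ht, hg, he]
    have : Complex.exp (Complex.I * (μ - z) * t) =
        Complex.exp (-(Complex.I * z * t)) * Complex.exp (Complex.I * μ * t) := by
      rw [← Complex.exp_add]; ring_nf
    simp only [this]
    ring
  have heb : ∀ᵐ t ∂ν, ‖e t‖ ≤ Real.exp (‖(z - μ : ℂ)‖ * Real.pi) := by
    filter_upwards [ae_restrict_mem measurableSet_Ioo] with t ht
    have := norm_cexp_neg_I_mul_le (z := z - μ) ht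
    rwa [show -(Complex.I * (z - μ) * t) = Complex.I * (μ - z) * (t : ℂ) by ring] at this
  have hei : Integrable e ν :=
    (MemLp.of_bound (p := 1) (by fun_prop) _ heb).integrable le_rfl
  have h2 : ∫ t, e t * Φ t ∂ν = ∫ s, f s * ((e Real.pi - e s) / (Complex.I * (μ - z))) ∂ν := by
    have h3 : ∀ t, e t * Φ t = ∫ s, {p : ℝ × ℝ | p.2 < p.1}.indicator
        (fun p => e p.1 * f p.2) (t, s) ∂ν := by
      intro t
      rw [hΦ, ← integral_const_mul]
      refine integral_congr_ae (Eventually.of_forall fun s => ?_)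
      by_cases hst : s < t <;> simp [Set.indicator, hst]
    simp_rw [h3]
    have hint : Integrable ({p : ℝ × ℝ | p.2 < p.1}.indicator
        (fun p => e p.1 * f p.2)) (ν.prod ν) :=
      (hei.mul_prod hfi).indicator (measurableSet_lt measurable_snd measurable_fst)
    rw [integral_integral_swap (f := fun t s => {p : ℝ × ℝ | p.2 < p.1}.indicator
        (fun p => e p.1 * f p.2) (t, s)) hint]
    refine integral_congr_ae ?_
    filter_upwards [ae_restrict_mem measurableSet_Ioo] with s hs
    rw [← he_int s hs, ← integral_const_mul]
    refine integral_congr_ae (Eventually.of_forall fun t => ?_)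
    by_cases hst : s < t <;> simp [Set.indicator, hst, mul_comm]
  have h4 : ∫ s, f s * ((e Real.pi - e s) / (Complex.I * (μ - z))) ∂ν =
      -(fourierEntire φ z) / (Complex.I * (μ - z)) := by
    have h5 : ∀ s, f s * ((e Real.pi - e s) / (Complex.I * (μ - z))) =
        (e Real.pi / (Complex.I * (μ - z))) * f s -
        (1 / (Complex.I * (μ - z))) * (Complex.exp (-(Complex.I * z * s)) * φ s) := by
      intro s
      have : Complex.exp (-(Complex.I * z * s)) =
          Complex.exp (-(Complex.I * μ * s)) * e s := by
        rw [he, ← Complex.exp_add]; ring_nf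
      rw [this, hf]
      field_simp
    have hi : Integrable (fun s : ℝ => Complex.exp (-(Complex.I * z * s)) * φ s) ν := by
      refine hφ.bdd_mul (c := Real.exp (‖z‖ * Real.pi)) (by fun_prop) ?_
      filter_upwards [ae_restrict_mem measurableSet_Ioo] with t ht
      exact norm_cexp_neg_I_mul_le ht
    simp_rw [h5]
    rw [integral_sub (hfi.const_mul _) (hi.const_mul _), integral_const_mul, integral_const_mul,
      hf0, ← fourierEntire_eq_integral]
    ring
  rw [h1, integral_const_mul, h2, h4]
  have : (μ : ℂ) - z ≠ 0 := sub_ne_zero.2 hz.symm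
  field_simp
  ring

theorem IsCompleteSystem.eq_zero_of_inner_eq_zero {H : Type*} [NormedAddCommGroup H]
    [InnerProductSpace ℂ H] {S : Set H} (hS : IsCompleteSystem S) {x : H}
    (hx : ∀ v ∈ S, inner ℂ v x = 0) : x = 0 := by
  have h1 : x ∈ (Submodule.span ℂ S)ᗮ := by
    rw [Submodule.mem_orthogonal]
    intro v hv
    induction hv using Submodule.span_induction with
    | mem v hv => exact hx v hv
    | zero => exact inner_zero_left _
    | add u v _ _ hu hv => rw [inner_add_left, hu, hv, add_zero]
    | smul c v _ hv => rw [inner_smul_left, hv, mul_zero]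
  rw [← Submodule.orthogonal_closure, hS, Submodule.top_orthogonal_eq_bot] at h1
  exact (Submodule.mem_bot ℂ).1 h1

theorem isCompleteSystem_of_inner_eq_zero {H : Type*} [NormedAddCommGroup H]
    [InnerProductSpace ℂ H] [CompleteSpace H] {S : Set H}
    (hS : ∀ x : H, (∀ v ∈ S, inner ℂ v x = 0) → x = 0) : IsCompleteSystem S := by
  rw [IsCompleteSystem, Submodule.topologicalClosure_eq_top_iff, Submodule.eq_bot_iff]
  intro x hx
  exact hS x fun v hv => (Submodule.mem_orthogonal _ _).1 hx v (Submodule.subset_span hv)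

theorem fourierEntire_eq_zero_of_mul {φ : L2pi} {μ : ℂ}
    (h : ∀ z : ℂ, (z - μ) * fourierEntire φ z = 0) (z : ℂ) : fourierEntire φ z = 0 := by
  have h1 : Set.EqOn (fourierEntire φ) (fun _ => 0) {μ}ᶜ := fun z hz =>
    (mul_eq_zero.1 (h z)).resolve_left (sub_ne_zero.2 hz)
  exact congrFun (Continuous.ext_on (dense_compl_singleton μ)
    (differentiable_fourierEntire φ).continuous continuous_const h1) z

/-- A set of frequencies is a uniqueness set if a function in `L²(-π, π)` is determined by the
values of its Fourier transform on it. -/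
def IsUniquenessSet (Λ : Set ℝ) : Prop :=
  ∀ φ : L2pi, (∀ a ∈ Λ, fourierEntire φ a = 0) → φ = 0

theorem IsCompleteSystem.isUniquenessSet {Λ : Set ℝ}
    (h : IsCompleteSystem (exponential '' Λ)) : IsUniquenessSet Λ := by
  intro φ hφ
  refine h.eq_zero_of_inner_eq_zero ?_
  rintro _ ⟨a, ha, rfl⟩
  rw [← fourierEntire_ofReal, hφ a ha]

section Biorthogonal

variable {Λ : Set ℝ} {w : ℝ → L2pi}

theorem IsBiorthogonalTo.fourierEntire_self (hw : IsBiorthogonalTo Λ w) {a : ℝ} (ha : a ∈ Λ) :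
    fourierEntire (w a) a = 1 := by
  rw [fourierEntire_ofReal, hw.1 a ha]

theorem IsBiorthogonalTo.fourierEntire_of_ne (hw : IsBiorthogonalTo Λ w) {a b : ℝ}
    (ha : a ∈ Λ) (hb : b ∈ Λ) (hab : a ≠ b) : fourierEntire (w b) a = 0 := by
  rw [fourierEntire_ofReal, hw.2 a ha b hb hab]

/-- The functions `(z - a) ŵ_a(z)` of a complete biorthogonal system are proportional to each
other. -/
theorem IsBiorthogonalTo.exists_ratio (hw : IsBiorthogonalTo Λ w) (hΛ : IsUniquenessSet Λ)
    {a b : ℝ} (ha : a ∈ Λ) (hb : b ∈ Λ) :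
    ∃ κ : ℂ, κ ≠ 0 ∧ ∀ z : ℂ,
      (z - a) * fourierEntire (w a) z = κ * ((z - b) * fourierEntire (w b) z) := by
  rcases eq_or_ne a b with rfl | hab
  · exact ⟨1, one_ne_zero, fun z => (one_mul _).symm⟩
  obtain ⟨ψ, hψ⟩ := exists_fourierEntire_div (w a) b (hw.fourierEntire_of_ne hb ha hab.symm)
  set χ : L2pi := w a + ((b : ℂ) - a) • ψ with hχ
  have hχz : ∀ z : ℂ, (z - b) * fourierEntire χ z = (z - a) * fourierEntire (w a) z := by
    intro z
    rw [hχ, fourierEntire_add, fourierEntire_smul]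
    linear_combination ((b : ℂ) - a) * hψ z
  have hχ0 : ∀ ν ∈ Λ, ν ≠ b → fourierEntire χ ν = 0 := by
    intro ν hν hνb
    have h1 := hχz ν
    have h2 : ((ν : ℂ) - a) * fourierEntire (w a) ν = 0 := by
      rcases eq_or_ne ν a with rfl | h
      · simp
      · rw [hw.fourierEntire_of_ne hν ha h, mul_zero]
    rw [h2] at h1
    exact (mul_eq_zero.1 h1).resolve_left (sub_ne_zero.2 (by exact_mod_cast hνb))
  have hχw : χ = fourierEntire χ b • w b := by
    refine sub_eq_zero.1 (hΛ _ fun ν hν => ?_)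
    rw [sub_eq_add_neg, ← neg_smul, fourierEntire_add, fourierEntire_smul]
    rcases eq_or_ne ν b with rfl | h
    · rw [hw.fourierEntire_self hν]; ring
    · rw [hw.fourierEntire_of_ne hν hb h, hχ0 ν hν h]; ring
  refine ⟨fourierEntire χ b, fun h0 => ?_, fun z => ?_⟩
  · rw [h0, zero_smul] at hχw
    have h3 : ∀ z : ℂ, (z - a) * fourierEntire (w a) z = 0 := by
      intro z
      rw [← hχz z, hχw, fourierEntire, inner_zero_right, mul_zero]
    have := fourierEntire_eq_zero_of_mul h3 a
    rw [hw.fourierEntire_self ha] at this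
    exact one_ne_zero this
  · rw [← hχz z, hχw, fourierEntire_smul, ← hχw]
    ring

/-- The Fourier transform of a member of a complete biorthogonal system has no real zeros other
than the frequencies of the system. -/
theorem IsBiorthogonalTo.mem_of_fourierEntire_eq_zero (hw : IsBiorthogonalTo Λ w)
    (hΛ : IsUniquenessSet Λ) {a x : ℝ} (ha : a ∈ Λ) (hx : fourierEntire (w a) x = 0) :
    x ∈ Λ := by
  by_contra hxΛ
  have hxa : (x : ℂ) - a ≠ 0 := sub_ne_zero.2 (by rintro h; exact hxΛ (by rwa [Complex.ofReal_injective h]))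
  obtain ⟨ψ, hψ⟩ := exists_fourierEntire_div (w a) x hx
  have h1 : w a + ((x : ℂ) - a) • ψ = 0 := by
    refine hΛ _ fun ν hν => ?_
    rw [fourierEntire_add, fourierEntire_smul]
    have hνx : (ν : ℂ) - x ≠ 0 :=
      sub_ne_zero.2 (by rintro h; exact hxΛ (by rwa [← Complex.ofReal_injective h]))
    refine mul_left_cancel₀ hνx ?_
    have h2 := hψ ν
    rcases eq_or_ne ν a with rfl | h
    · rw [hw.fourierEntire_self hν] at h2 ⊢
      linear_combination ((x : ℂ) - ν) * h2
    · rw [hw.fourierEntire_of_ne hν ha h] at h2 ⊢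
      linear_combination ((x : ℂ) - a) * h2
  have h3 : ∀ z : ℂ, (z - a) * fourierEntire ψ z = 0 := by
    intro z
    have h4 : fourierEntire (w a + ((x : ℂ) - a) • ψ) z = 0 := by
      rw [h1, fourierEntire, inner_zero_right]
    rw [fourierEntire_add, fourierEntire_smul] at h4
    linear_combination h4 + hψ z
  have h5 := hψ a
  rw [fourierEntire_eq_zero_of_mul h3 a, hw.fourierEntire_self ha, mul_zero] at h5
  exact zero_ne_one h5

end Biorthogonal

section Riesz

variable {H ι : Type*} [NormedAddCommGroup H] [InnerProductSpace ℂ H]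

/-- The biorthogonal system of a Riesz basis, and the two-sided estimates and expansions that come
with it. -/
structure IsRieszDual (v u : ι → H) : Prop where
  inner_self : ∀ i, inner ℂ (v i) (u i) = 1
  inner_ne : ∀ i j, i ≠ j → inner ℂ (v i) (u j) = 0
  hasSum : ∀ x y, HasSum (fun i => inner ℂ x (u i) * inner ℂ (v i) y) (inner ℂ x y)
  summable_left : ∀ y, Summable fun i => ‖inner ℂ (v i) y‖ ^ 2
  summable_right : ∀ x, Summable fun i => ‖inner ℂ x (u i)‖ ^ 2
  norm_le : ∃ C : ℝ, 0 < C ∧ ∀ x, ‖x‖ ^ 2 ≤ C * ∑' i, ‖inner ℂ x (u i)‖ ^ 2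
  interpolation : ∀ c : ι → ℂ, (Summable fun i => ‖c i‖ ^ 2) → ∃ K, ∀ i, inner ℂ (v i) K = c i

theorem HilbertBasis.hasSum_norm_sq (b : HilbertBasis ι ℂ H) (x : H) :
    HasSum (fun i => ‖inner ℂ (b i) x‖ ^ 2) (‖x‖ ^ 2) := by
  have h := (b.hasSum_inner_mul_inner x x).mapL Complex.reCLM
  have h2 : Complex.reCLM (inner ℂ x x) = ‖x‖ ^ 2 := by
    rw [inner_self_eq_norm_sq_to_K]
    norm_cast
  rw [h2] at h
  refine h.congr_fun fun i => ?_
  rw [← inner_conj_symm x, Complex.reCLM_apply, RCLike.conj_mul]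
  norm_cast

theorem IsRieszBasis.exists_dual [CompleteSpace H] {v : ι → H} (hv : IsRieszBasis v) :
    ∃ u : ι → H, IsRieszDual v u := by
  obtain ⟨b, T, hT⟩ := hv
  set A : H →L[ℂ] H := ContinuousLinearMap.adjoint (T : H →L[ℂ] H) with hA
  set B : H →L[ℂ] H := ContinuousLinearMap.adjoint (T.symm : H →L[ℂ] H) with hB
  have hvy : ∀ i y, inner ℂ (v i) y = inner ℂ (b i) (A y) := by
    intro i y
    rw [hT, hA, ContinuousLinearMap.adjoint_inner_right]; rfl
  have hxu : ∀ i x, inner ℂ x (B (b i)) = inner ℂ (T.symm x) (b i) := by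
    intro i x
    rw [hB, ContinuousLinearMap.adjoint_inner_right]; rfl
  have hTA : ∀ x y, inner ℂ (T.symm x) (A y) = inner ℂ x y := by
    intro x y
    rw [hA, ContinuousLinearMap.adjoint_inner_right]
    simp
  have hAB : ∀ x, A (B x) = x := by
    intro x
    refine ext_inner_left ℂ fun y => ?_
    rw [hA, ContinuousLinearMap.adjoint_inner_right, hB, ContinuousLinearMap.adjoint_inner_right]
    simp
  refine ⟨fun i => B (b i), ?_, ?_, ?_, ?_, ?_, ?_, ?_⟩
  · intro i
    rw [hxu, hT, T.symm_apply_apply, inner_self_eq_norm_sq_to_K, b.orthonormal.1 i]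
    simp
  · intro i j hij
    rw [hxu, hT, T.symm_apply_apply, b.orthonormal.2 hij]
  · intro x y
    simp_rw [hxu, hvy, ← hTA x y]
    exact b.hasSum_inner_mul_inner _ _
  · intro y
    simp_rw [hvy]
    exact (b.hasSum_norm_sq _).summable
  · intro x
    simp_rw [hxu, norm_inner_symm (T.symm x)]
    exact (b.hasSum_norm_sq _).summable
  · refine ⟨(‖(T : H →L[ℂ] H)‖ + 1) ^ 2, by positivity, fun x => ?_⟩
    simp_rw [hxu, norm_inner_symm (T.symm x)]
    rw [(b.hasSum_norm_sq _).tsum_eq, ← mul_pow]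
    refine pow_le_pow_left₀ (norm_nonneg _) ?_ 2
    calc ‖x‖ = ‖(T : H →L[ℂ] H) (T.symm x)‖ := by simp
      _ ≤ ‖(T : H →L[ℂ] H)‖ * ‖T.symm x‖ := ContinuousLinearMap.le_opNorm _ _
      _ ≤ _ := by gcongr; linarith
  · intro c hc
    have hc' : Memℓp c 2 := memℓp_gen (by simpa using hc)
    refine ⟨B (b.repr.symm ⟨c, hc'⟩), fun i => ?_⟩
    rw [hvy, hAB, ← b.repr_apply_apply, LinearIsometryEquiv.apply_symm_apply]

theorem IsRieszDual.eq_zero {v u : ι → H} (h : IsRieszDual v u) {y : H}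
    (hy : ∀ i, inner ℂ (v i) y = 0) : y = 0 := by
  have h1 := h.hasSum y y
  simp only [hy, mul_zero] at h1
  exact inner_self_eq_zero.1 (h1.unique hasSum_zero)

end Riesz

theorem IsBiorthogonalTo.linearIndependent {Λ : Set ℝ} {w : ℝ → L2pi}
    (hw : IsBiorthogonalTo Λ w) : LinearIndependent ℂ (fun a : Λ => w a) := by
  rw [linearIndependent_iff']
  intro s g hg a ha
  have h1 : inner ℂ (exponential a) (∑ b ∈ s, g b • w b) = 0 := by rw [hg, inner_zero_right]
  rw [inner_sum, Finset.sum_eq_single a] at h1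
  · rwa [inner_smul_right, hw.1 a a.2, mul_one] at h1
  · intro b _ hba
    rw [inner_smul_right, hw.2 a a.2 b b.2 (fun h => hba (Subtype.ext h.symm)), mul_zero]
  · exact fun h => absurd ha h

theorem IsRieszDual.isBiorthogonalTo {Z : Set ℝ} {U : ℝ → L2pi}
    (hU : IsRieszDual (fun a : Z => exponential a) (fun a : Z => U a)) : IsBiorthogonalTo Z U :=
  ⟨fun a ha => hU.inner_self ⟨a, ha⟩,
    fun a ha b hb hab => hU.inner_ne ⟨a, ha⟩ ⟨b, hb⟩ (fun h => hab (congrArg Subtype.val h))⟩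

theorem IsRieszDual.isUniquenessSet {Z : Set ℝ} {U : ℝ → L2pi}
    (hU : IsRieszDual (fun a : Z => exponential a) (fun a : Z => U a)) : IsUniquenessSet Z := by
  intro φ hφ
  refine hU.eq_zero fun a => ?_
  rw [← fourierEntire_ofReal, hφ a a.2]

/-- If two frequency sets of complete biorthogonal systems differ by finitely many elements of the
second one, every functional that annihilates the `w_a` with `a = a₀` or `a ∉ Z` annihilates the
exceptional elements of the second system. -/
theorem inner_eq_zero_of_finite_exception {Λ Z : Set ℝ} {w U : ℝ → L2pi}
    (hΛ : IsUniquenessSet Λ) (hw : IsBiorthogonalTo Λ w)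
    (hZ : IsUniquenessSet Z) (hU : IsBiorthogonalTo Z U) {a₀ : ℝ} (ha₀ : a₀ ∈ Λ)
    (hJ : {ζ ∈ Z | fourierEntire (w a₀) ζ ≠ 0}.Finite) {h : L2pi}
    (hh : ∀ a ∈ Λ, (a = a₀ ∨ a ∉ Z) → inner ℂ h (w a) = 0) {ζ : ℝ}
    (hζ : ζ ∈ Z) (hζw : fourierEntire (w a₀) ζ ≠ 0) : inner ℂ h (U ζ) = 0 := by
  classical
  set J := {ζ ∈ Z | fourierEntire (w a₀) ζ ≠ 0} with hJdef
  set E := {a ∈ Λ | a = a₀ ∨ a ∉ Z} with hE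
  have hmem : ∀ ζ ∈ Z, ζ ∉ J → ζ ∈ Λ ∧ ζ ≠ a₀ := by
    intro ζ hζ hζJ
    have h0 : fourierEntire (w a₀) ζ = 0 := by
      by_contra h0
      exact hζJ ⟨hζ, h0⟩
    refine ⟨hw.mem_of_fourierEntire_eq_zero hΛ ha₀ h0, ?_⟩
    rintro rfl
    rw [hw.fourierEntire_self ha₀] at h0
    exact one_ne_zero h0
  have hspan : ∀ a ∈ E, w a ∈ Submodule.span ℂ (U '' J) := by
    rintro a ⟨ha, haE⟩
    have h1 : w a = ∑ ζ ∈ hJ.toFinset, fourierEntire (w a) ζ • U ζ := by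
      refine sub_eq_zero.1 (hZ _ fun ξ hξ => ?_)
      rw [fourierEntire, inner_sub_right, inner_sum]
      simp_rw [inner_smul_right]
      change fourierEntire (w a) ξ - ∑ ζ ∈ hJ.toFinset, fourierEntire (w a) ζ *
        fourierEntire (U ζ) ξ = 0
      by_cases hξJ : ξ ∈ J
      · rw [Finset.sum_eq_single ξ]
        · rw [hU.fourierEntire_self hξ]; ring
        · intro ζ hζ hne
          rw [hU.fourierEntire_of_ne hξ (hJ.mem_toFinset.1 hζ).1 hne.symm, mul_zero]
        · exact fun h => absurd (hJ.mem_toFinset.2 hξJ) h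
      · obtain ⟨hξΛ, hξa⟩ := hmem ξ hξ hξJ
        have hne : ξ ≠ a := by
          rintro rfl
          exact haE.elim hξa (fun h => h hξ)
        rw [hw.fourierEntire_of_ne hξΛ ha hne, Finset.sum_eq_zero, sub_zero]
        intro ζ hζ
        have hζJ := hJ.mem_toFinset.1 hζ
        rw [hU.fourierEntire_of_ne hξ hζJ.1 (by rintro rfl; exact hξJ hζJ), mul_zero]
    rw [h1]
    exact Submodule.sum_mem _ fun ζ hζ => Submodule.smul_mem _ _
      (Submodule.subset_span ⟨ζ, hJ.mem_toFinset.1 hζ, rfl⟩)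
  have hEfin : E.Finite := by
    have : FiniteDimensional ℂ (Submodule.span ℂ (U '' J)) :=
      FiniteDimensional.span_of_finite ℂ (hJ.image U)
    have hli : LinearIndependent ℂ
        (fun a : E => (⟨w a, hspan a a.2⟩ : Submodule.span ℂ (U '' J))) := by
      refine LinearIndependent.of_comp (Submodule.subtype _) ?_
      exact hw.linearIndependent.comp (fun a : E => (⟨a, a.2.1⟩ : Λ))
        (fun a b hab => Subtype.ext (congrArg (fun x : Λ => (x : ℝ)) hab))
    have := hli.finite
    exact Set.toFinite E
  have h2 : U ζ = ∑ a ∈ hEfin.toFinset, fourierEntire (U ζ) a • w a := by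
    refine sub_eq_zero.1 (hΛ _ fun ν hν => ?_)
    rw [fourierEntire, inner_sub_right, inner_sum]
    simp_rw [inner_smul_right]
    change fourierEntire (U ζ) ν - ∑ a ∈ hEfin.toFinset, fourierEntire (U ζ) a *
      fourierEntire (w a) ν = 0
    by_cases hνE : ν ∈ E
    · rw [Finset.sum_eq_single ν]
      · rw [hw.fourierEntire_self hν]; ring
      · intro a ha hne
        rw [hw.fourierEntire_of_ne hν (hEfin.mem_toFinset.1 ha).1 hne.symm, mul_zero]
      · exact fun h => absurd (hEfin.mem_toFinset.2 hνE) h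
    · have hνZ : ν ∈ Z := by
        by_contra hc
        exact hνE ⟨hν, Or.inr hc⟩
      have hνa : ν ≠ a₀ := fun hc => hνE ⟨hν, Or.inl hc⟩
      have hne : ν ≠ ζ := by
        rintro rfl
        exact hζw (hw.fourierEntire_of_ne hν ha₀ hνa)
      rw [hU.fourierEntire_of_ne hνZ hζ hne, Finset.sum_eq_zero, sub_zero]
      intro a ha
      have haE := hEfin.mem_toFinset.1 ha
      rw [hw.fourierEntire_of_ne hν haE.1 (by rintro rfl; exact hνE haE), mul_zero]
  rw [h2, inner_sum]
  refine Finset.sum_eq_zero fun a ha => ?_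
  have haE := hEfin.mem_toFinset.1 ha
  rw [inner_smul_right, hh a haE.1 haE.2, mul_zero]

/-- A mixed system is complete if the exponential part extends to a Riesz basis of exponentials
whose generating function has a bounded derivative `d` at its zeros. -/
theorem isCompleteSystem_mixedSystem_of_bounded {Λ Λ₁ Z : Set ℝ} {w U : ℝ → L2pi}
    (hΛ : IsUniquenessSet Λ) (hw : IsBiorthogonalTo Λ w) (hZ : Λ₁ ⊆ Z)
    (hU : IsRieszDual (fun a : Z => exponential a) (fun a : Z => U a))
    {Φ d : ℝ → ℂ} {C : ℝ} (hd : ∀ ζ ∈ Z, ‖d ζ‖ ≤ C) (hd0 : ∀ ζ ∈ Z, d ζ ≠ 0)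
    (hΦ : ∀ ζ ∈ Z, ∀ x : ℝ, d ζ * ((x - ζ) * fourierEntire (U ζ) x) = Φ x) :
    IsCompleteSystem (mixedSystem Λ Λ₁ w) := by
  refine isCompleteSystem_of_inner_eq_zero fun h hh => ?_
  have h1 : ∀ a ∈ Λ₁, fourierEntire h a = 0 := fun a ha => by
    rw [fourierEntire_ofReal]
    exact hh _ (Or.inl ⟨a, ha, rfl⟩)
  have h2 : ∀ a ∈ Λ, a ∉ Λ₁ → inner ℂ h (w a) = 0 := fun a ha ha1 => by
    rw [← inner_conj_symm, hh _ (Or.inr ⟨a, ⟨ha, ha1⟩, rfl⟩), map_zero]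
  by_cases hne : ∃ a₀ ∈ Λ, a₀ ∉ Λ₁
  swap
  · push Not at hne
    exact hΛ h fun a ha => h1 a (hne a ha)
  obtain ⟨a₀, ha₀, ha₀1⟩ := hne
  have hUb := hU.isBiorthogonalTo
  have hUu := hU.isUniquenessSet
  set α : ℝ → ℂ := fun ζ => inner ℂ h (U ζ) with hα
  have hs : ∀ y : L2pi, HasSum (fun ζ : Z => α ζ * fourierEntire y ζ) (inner ℂ h y) := by
    intro y
    simpa only [fourierEntire_ofReal] using hU.hasSum h y
  have key : ∀ ζ ∈ Z, fourierEntire (w a₀) ζ ≠ 0 → α ζ = 0 := by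
    have hαsum : Summable fun ζ : Z => ‖α ζ‖ ^ 2 := hU.summable_right h
    have hα0 : Tendsto (fun ζ : Z => ‖α ζ‖) cofinite (𝓝 0) := by
      have := hαsum.tendsto_cofinite_zero.sqrt
      simpa [Real.sqrt_sq] using this
    have hwsum : Summable fun ζ : Z => ‖fourierEntire (w a₀) ζ‖ ^ 2 := by
      simpa only [fourierEntire_ofReal] using hU.summable_left (w a₀)
    have hcoef : Summable fun ζ : Z => ‖α ζ * d ζ * fourierEntire (w a₀) ζ‖ ^ 2 := by
      obtain ⟨M, hM⟩ : ∃ M, ∀ ζ : Z, ‖α ζ‖ ^ 2 ≤ M :=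
        ⟨∑' ζ : Z, ‖α ζ‖ ^ 2, fun ζ => hαsum.le_tsum ζ fun _ _ => by positivity⟩
      refine Summable.of_nonneg_of_le (fun _ => by positivity) (fun ζ => ?_)
        (hwsum.mul_left (M * C ^ 2))
      rw [norm_mul, norm_mul, mul_pow, mul_pow]
      have := hM ζ
      have hdζ := hd ζ ζ.2
      gcongr
      exact (sq_nonneg _).trans this
    obtain ⟨K, hK⟩ := hU.interpolation _ hcoef
    have hK0 : ∀ ν ∈ Λ, ν ≠ a₀ → fourierEntire K ν = 0 := by
      intro ν hν hνa
      by_cases hνZ : ν ∈ Z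
      · rw [fourierEntire_ofReal, hK ⟨ν, hνZ⟩, hw.fourierEntire_of_ne hν ha₀ hνa, mul_zero]
      · obtain ⟨κ, -, hκ⟩ := hw.exists_ratio hΛ ha₀ hν
        have hs1 := hs (w a₀)
        rw [h2 a₀ ha₀ ha₀1] at hs1
        have hs2 := hs (w ν)
        rw [h2 ν hν fun hc => hνZ (hZ hc)] at hs2
        have hs3 := (hs1.sub (hs2.mul_left κ)).mul_left (Φ ν / (ν - a₀))
        have hs4 := hU.hasSum (exponential ν) K
        rw [fourierEntire_ofReal]
        refine (hs4.unique (hs3.congr_fun fun ζ => ?_)).trans (by ring)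
        rw [hK, ← hΦ ζ ζ.2 ν, ← fourierEntire_ofReal]
        have hne1 : (ν : ℂ) - a₀ ≠ 0 := sub_ne_zero.2 (by exact_mod_cast hνa)
        have hne2 : ((ζ : ℝ) : ℂ) - ν ≠ 0 :=
          sub_ne_zero.2 (by rintro hc; exact hνZ (by rw [← Complex.ofReal_injective hc]; exact ζ.2))
        have := hκ (ζ : ℝ)
        field_simp
        linear_combination fourierEntire (U ζ) ν * α ζ * d ζ * this
    have hKw : K = fourierEntire K a₀ • w a₀ := by
      refine sub_eq_zero.1 (hΛ _ fun ν hν => ?_)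
      rw [sub_eq_add_neg, ← neg_smul, fourierEntire_add, fourierEntire_smul]
      rcases eq_or_ne ν a₀ with rfl | hc
      · rw [hw.fourierEntire_self hν]; ring
      · rw [hw.fourierEntire_of_ne hν ha₀ hc, hK0 ν hν hc]; ring
    set c := fourierEntire K a₀ with hc
    have hrel : ∀ ζ ∈ Z, fourierEntire (w a₀) ζ ≠ 0 → α ζ * d ζ = c := by
      intro ζ hζ hζw
      have h3 := hK ⟨ζ, hζ⟩
      rw [hKw, inner_smul_right] at h3
      simp only [← fourierEntire_ofReal] at h3
      exact (mul_right_cancel₀ hζw h3).symm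
    by_cases hJ : {ζ ∈ Z | fourierEntire (w a₀) ζ ≠ 0}.Finite
    · intro ζ hζ hζw
      exact inner_eq_zero_of_finite_exception hΛ hw hUu hUb ha₀ hJ
        (fun a ha haE => h2 a ha (haE.elim (fun h => h ▸ ha₀1) fun h hc => h (hZ hc))) hζ hζw
    · have hc0 : c = 0 := by
        by_contra hc0
        have hcpos : 0 < ‖c‖ := norm_pos_iff.2 hc0
        have hev : ∀ᶠ ζ : Z in cofinite, ‖α ζ‖ * (|C| + 1) < ‖c‖ := by
          have := hα0.mul_const (|C| + 1)
          rw [zero_mul] at this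
          exact this.eventually (gt_mem_nhds hcpos)
        rw [eventually_cofinite] at hev
        refine hJ ((hev.image Subtype.val).subset ?_)
        rintro ζ ⟨hζ, hζw⟩
        refine ⟨⟨ζ, hζ⟩, ?_, rfl⟩
        change ¬ (‖α ζ‖ * (|C| + 1) < ‖c‖)
        rw [not_lt, ← hrel ζ hζ hζw, norm_mul]
        gcongr
        exact (hd ζ hζ).trans ((le_abs_self C).trans (by linarith))
      intro ζ hζ hζw
      exact (mul_eq_zero.1 ((hrel ζ hζ hζw).trans hc0)).resolve_right (hd0 ζ hζ)
  have hterm : ∀ ζ : Z, α ζ * fourierEntire h ζ = 0 := by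
    intro ζ
    by_cases hζw : fourierEntire (w a₀) (ζ : ℝ) = 0
    swap
    · rw [key ζ ζ.2 hζw, zero_mul]
    have hζΛ := hw.mem_of_fourierEntire_eq_zero hΛ ha₀ hζw
    by_cases hζ1 : (ζ : ℝ) ∈ Λ₁
    · rw [h1 ζ hζ1, mul_zero]
    · have h3 := hs (w ζ)
      rw [h2 ζ hζΛ hζ1] at h3
      have h4 : HasSum (fun ξ : Z => α ξ * fourierEntire (w ζ) ξ)
          (α ζ * fourierEntire (w ζ) ζ) := by
        refine hasSum_single ζ fun ξ hξ => ?_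
        by_cases hξw : fourierEntire (w a₀) (ξ : ℝ) = 0
        · rw [hw.fourierEntire_of_ne (hw.mem_of_fourierEntire_eq_zero hΛ ha₀ hξw) hζΛ
            (fun hc => hξ (Subtype.ext hc)), mul_zero]
        · rw [key ξ ξ.2 hξw, zero_mul]
      have h5 := h4.unique h3
      rw [hw.fourierEntire_self hζΛ, mul_one] at h5
      rw [h5, zero_mul]
  have h6 := hs h
  simp only [hterm] at h6
  exact inner_self_eq_zero.1 (h6.unique hasSum_zero)

theorem fourierEntire_cexponential (w z : ℂ) :
    fourierEntire (cexponential w) z =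
      ∫ t in (-Real.pi)..Real.pi, Complex.exp (Complex.I * (w - z) * t) := by
  rw [fourierEntire_eq_integral,
    intervalIntegral.integral_of_le (by linarith [Real.pi_pos]), integral_Ioc_eq_integral_Ioo]
  refine integral_congr_ae ?_
  filter_upwards [coeFn_cexponential w] with t ht
  rw [ht, ← Complex.exp_add]
  ring_nf

theorem fourierEntire_cexponential_of_ne {w z : ℂ} (h : z ≠ w) :
    fourierEntire (cexponential w) z = 2 * Complex.sin ((w - z) * Real.pi) / (w - z) := by
  have hwz : w - z ≠ 0 := sub_ne_zero.2 h.symm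
  rw [fourierEntire_cexponential,
    integral_exp_mul_complex (mul_ne_zero Complex.I_ne_zero hwz), Complex.sin]
  have e1 : Complex.I * (w - z) * (Real.pi : ℂ) = (w - z) * Real.pi * Complex.I := by ring
  have e2 : Complex.I * (w - z) * ((-Real.pi : ℝ) : ℂ) = -((w - z) * Real.pi) * Complex.I := by
    push_cast; ring
  rw [e1, e2]
  field_simp
  ring_nf
  simp only [Complex.I_sq]
  ring

theorem inner_exponential_self (a : ℝ) :
    inner ℂ (exponential a) (exponential a) = 2 * Real.pi := by
  rw [← fourierEntire_ofReal, ← cexponential_ofReal, fourierEntire_cexponential]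
  simp
  ring

theorem inner_exponential_of_ne {a b : ℝ} (h : a ≠ b) :
    inner ℂ (exponential a) (exponential b) =
      2 * Complex.sin ((b - a) * Real.pi) / (b - a) := by
  rw [← fourierEntire_ofReal, ← cexponential_ofReal,
    fourierEntire_cexponential_of_ne (by exact_mod_cast h)]

theorem isUniquenessSet_int : IsUniquenessSet (Set.range fun n : ℤ => (n : ℝ)) := by
  intro φ hφ
  have hab : -Real.pi < Real.pi := by linarith [Real.pi_pos]
  have hL2 : MemLp φ 2 (volume.restrict (Set.Ioc (-Real.pi) Real.pi)) := by
    rw [← restrict_Ioo_eq_restrict_Ioc]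
    exact Lp.memLp φ
  have h1 := hasSum_sq_fourierCoeffOn hab hL2
  have h2 : ∀ n : ℤ, fourierCoeffOn hab φ n = 0 := by
    intro n
    rw [fourierCoeffOn_eq_integral, intervalIntegral.integral_of_le hab.le,
      integral_Ioc_eq_integral_Ioo]
    have h3 := hφ n ⟨n, rfl⟩
    rw [fourierEntire_eq_integral] at h3
    have h4 : ∀ t : ℝ, (fourier (-n) (t : AddCircle (Real.pi - -Real.pi)) : ℂ) • φ t =
        Complex.exp (-(Complex.I * ((n : ℝ) : ℂ) * t)) * φ t := by
      intro t
      rw [fourier_coe_apply, smul_eq_mul]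
      congr 2
      have := Complex.ofReal_ne_zero.2 Real.pi_ne_zero
      push_cast
      field_simp
      ring
    simp_rw [h4, h3, smul_zero]
  simp only [h2, norm_zero, ne_eq, OfNat.ofNat_ne_zero, not_false_eq_true, zero_pow] at h1
  have h5 := h1.unique hasSum_zero
  rw [intervalIntegral.integral_of_le hab.le, integral_Ioc_eq_integral_Ioo] at h5
  have hpi : (Real.pi - -Real.pi)⁻¹ ≠ 0 := by
    have := Real.pi_pos
    positivity
  have h6 := (smul_eq_zero.1 h5).resolve_left hpi
  rw [← L2pi.norm_sq_eq_integral] at h6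
  exact norm_eq_zero.1 (pow_eq_zero_iff two_ne_zero |>.1 h6)

theorem isRieszBasis_int :
    IsRieszBasis (fun a : ↥(Set.range fun n : ℤ => (n : ℝ)) => exponential a) := by
  set Z := Set.range fun n : ℤ => (n : ℝ) with hZ
  have hpos : (0 : ℝ) < Real.sqrt (2 * Real.pi) := Real.sqrt_pos.2 (by positivity)
  have hs : (Real.sqrt (2 * Real.pi) : ℂ) ≠ 0 := Complex.ofReal_ne_zero.2 hpos.ne'
  have hsq : (Real.sqrt (2 * Real.pi) : ℂ) * Real.sqrt (2 * Real.pi) = 2 * Real.pi := by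
    rw [← Complex.ofReal_mul, Real.mul_self_sqrt (by positivity)]
    push_cast; ring
  set v : Z → L2pi := fun a => (Real.sqrt (2 * Real.pi) : ℂ)⁻¹ • exponential a with hv
  have hon : Orthonormal ℂ v := by
    classical
    rw [orthonormal_iff_ite]
    intro a b
    rw [hv]
    simp only [inner_smul_left, inner_smul_right, map_inv₀, Complex.conj_ofReal]
    split_ifs with hab
    · subst hab
      rw [inner_exponential_self, ← hsq]
      field_simp
    · obtain ⟨a, m, rfl⟩ := a
      obtain ⟨b, n, rfl⟩ := b
      have hne : (m : ℝ) ≠ n := fun h => hab (Subtype.ext h)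
      simp only
      rw [inner_exponential_of_ne hne]
      have : Complex.sin ((((n : ℝ) : ℂ) - ((m : ℝ) : ℂ)) * Real.pi) = 0 := by
        have := Complex.sin_int_mul_pi (n - m)
        push_cast at this ⊢
        exact this
      rw [this]
      ring
  have hbot : (Submodule.span ℂ (Set.range v))ᗮ = ⊥ := by
    rw [Submodule.eq_bot_iff]
    intro x hx
    refine isUniquenessSet_int x fun a ha => ?_
    have h1 := (Submodule.mem_orthogonal _ _).1 hx (v ⟨a, ha⟩)
      (Submodule.subset_span ⟨⟨a, ha⟩, rfl⟩)
    rw [hv, inner_smul_left] at h1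
    rw [fourierEntire_ofReal]
    exact (mul_eq_zero.1 h1).resolve_left (by simpa using hs)
  refine ⟨HilbertBasis.mkOfOrthogonalEqBot hon hbot,
    ContinuousLinearEquiv.smulLeft (Units.mk0 _ hs), fun a => ?_⟩
  rw [HilbertBasis.coe_mkOfOrthogonalEqBot]
  change _ = (Real.sqrt (2 * Real.pi) : ℂ) • ((Real.sqrt (2 * Real.pi) : ℂ)⁻¹ • exponential a)
  rw [smul_smul, mul_inv_cancel₀ hs, one_smul]

/-- The biorthogonal system of a Riesz basis of exponentials, as a family indexed by `ℝ`. -/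
theorem IsRieszBasis.exists_dual_exponential {Z : Set ℝ}
    (h : IsRieszBasis (fun a : Z => exponential a)) :
    ∃ U : ℝ → L2pi, IsRieszDual (fun a : Z => exponential a) (fun a : Z => U a) := by
  classical
  obtain ⟨u, hu⟩ := h.exists_dual
  refine ⟨fun a => if ha : a ∈ Z then u ⟨a, ha⟩ else 0, ?_⟩
  convert hu using 2 with a
  exact dif_pos a.2

theorem isCompleteSystem_mixedSystem_of_subset_int {Λ Λ₁ : Set ℝ} {w : ℝ → L2pi}
    (hΛ : IsUniquenessSet Λ) (hw : IsBiorthogonalTo Λ w)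
    (h : Λ₁ ⊆ Set.range fun n : ℤ => (n : ℝ)) :
    IsCompleteSystem (mixedSystem Λ Λ₁ w) := by
  obtain ⟨U, hU⟩ := isRieszBasis_int.exists_dual_exponential
  have hUb := hU.isBiorthogonalTo
  have hpi : (Real.pi : ℂ) ≠ 0 := Complex.ofReal_ne_zero.2 Real.pi_ne_zero
  have hUn : ∀ n : ℤ, U n = (2 * Real.pi : ℂ)⁻¹ • exponential n := by
    intro n
    refine sub_eq_zero.1 (isUniquenessSet_int _ ?_)
    rintro _ ⟨m, rfl⟩
    rw [sub_eq_add_neg, ← neg_smul, fourierEntire_add, fourierEntire_smul]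
    rcases eq_or_ne m n with rfl | hmn
    · rw [hUb.fourierEntire_self ⟨m, rfl⟩, fourierEntire_ofReal, inner_exponential_self]
      field_simp
      ring
    · have hne : (m : ℝ) ≠ n := by exact_mod_cast hmn
      rw [hUb.fourierEntire_of_ne ⟨m, rfl⟩ ⟨n, rfl⟩ hne, fourierEntire_ofReal,
        inner_exponential_of_ne hne]
      have := Complex.sin_int_mul_pi (n - m)
      push_cast at this ⊢
      rw [this]
      ring
  refine isCompleteSystem_mixedSystem_of_bounded (d := fun x => Complex.cos (x * Real.pi))
    (Φ := fun x => Complex.sin (x * Real.pi) / Real.pi) (C := 1) hΛ hw h hU ?_ ?_ ?_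
  · rintro _ ⟨n, rfl⟩
    simp only
    rw [← Complex.ofReal_mul, ← Complex.ofReal_cos, Complex.norm_real]
    exact Real.abs_cos_le_one _
  · rintro _ ⟨n, rfl⟩
    simp only
    rw [← Complex.ofReal_mul, ← Complex.ofReal_cos, Complex.ofReal_ne_zero]
    intro h0
    have := Real.sin_sq_add_cos_sq (n * Real.pi)
    rw [Real.sin_int_mul_pi, h0] at this
    norm_num at this
  · rintro _ ⟨n, rfl⟩ x
    simp only
    have hsin : Complex.sin (((n : ℝ) : ℂ) * Real.pi) = 0 := by
      have := Complex.sin_int_mul_pi n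
      push_cast
      exact this
    rcases eq_or_ne x n with rfl | hx
    · rw [hsin]; ring
    rw [hUn, fourierEntire_smul, fourierEntire_ofReal, inner_exponential_of_ne hx,
      sub_mul ((n : ℝ) : ℂ) (x : ℂ) (Real.pi : ℂ),
      Complex.sin_sub, hsin]
    have hxn : ((n : ℝ) : ℂ) - x ≠ 0 := sub_ne_zero.2 (by exact_mod_cast hx.symm)
    have h1 := Complex.sin_sq_add_cos_sq (((n : ℝ) : ℂ) * Real.pi)
    rw [hsin] at h1
    generalize Complex.sin (x * Real.pi) = s at *
    generalize Complex.cos (((n : ℝ) : ℂ) * Real.pi) = c at *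
    field_simp
    linear_combination (x - ((n : ℝ) : ℂ)) * (-1 : ℂ) * s * h1

/-- If entire functions converge pointwise and are eventually bounded on every disc, then their
limit is entire. -/
theorem differentiable_of_tendsto_of_bounded {f : ℕ → ℂ → ℂ} {F : ℂ → ℂ}
    (hf : ∀ n, Differentiable ℂ (f n)) (hlim : ∀ z, Tendsto (fun n => f n z) atTop (𝓝 (F z)))
    (hb : ∀ r : ℝ, ∃ M : ℝ, ∀ᶠ n in atTop, ∀ z : ℂ, ‖z‖ ≤ r → ‖f n z‖ ≤ M) :
    Differentiable ℂ F := by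
  intro z₀
  set R : NNReal := ‖z₀‖₊ + 1 with hR
  have hRpos : 0 < R := by positivity
  have hRr : ((R : NNReal) : ℝ) = ‖z₀‖ + 1 := by rw [hR]; push_cast; rfl
  obtain ⟨M, hM⟩ := hb R
  have hcirc : ∀ θ : ℝ, ‖circleMap 0 R θ‖ ≤ R := by
    intro θ
    rw [norm_circleMap_zero, abs_of_pos (by exact_mod_cast hRpos)]
  have hFM : ∀ z : ℂ, ‖z‖ ≤ R → ‖F z‖ ≤ M := fun z hz =>
    le_of_tendsto (hlim z).norm (hM.mono fun n hn => hn z hz)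
  have hFmeas : Measurable fun θ : ℝ => F (circleMap 0 R θ) :=
    measurable_of_tendsto_metrizable
      (fun n => ((hf n).continuous.comp (continuous_circleMap 0 R)).measurable)
      (tendsto_pi_nhds.2 fun θ => hlim (circleMap 0 R θ))
  have hFint : CircleIntegrable F 0 R := by
    rw [CircleIntegrable, intervalIntegrable_iff, Set.uIoc_of_le Real.two_pi_pos.le]
    exact (MemLp.of_bound (p := 1) hFmeas.aestronglyMeasurable M
      (Eventually.of_forall fun θ => hFM _ (hcirc θ))).integrable le_rfl
  have hcauchy : ∀ z ∈ Metric.ball (0 : ℂ) R, (2 * Real.pi * Complex.I : ℂ)⁻¹ •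
      ∮ w in C(0, R), (w - z)⁻¹ • F w = F z := by
    intro z hz
    have h1 : ∀ n, (2 * Real.pi * Complex.I : ℂ)⁻¹ • ∮ w in C(0, R), (w - z)⁻¹ • f n w = f n z :=
      fun n => (hf n).diffContOnCl.two_pi_i_inv_smul_circleIntegral_sub_inv_smul hz
    have hcont : Continuous fun θ : ℝ => (circleMap 0 R θ - z)⁻¹ := by
      refine Continuous.inv₀ (by fun_prop) fun θ h0 => ?_
      have h1 : ‖circleMap 0 R θ‖ = R := by
        rw [norm_circleMap_zero, abs_of_pos (by exact_mod_cast hRpos)]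
      rw [sub_eq_zero.1 h0] at h1
      rw [mem_ball_zero_iff] at hz
      exact hz.ne h1
    have h2 : Tendsto (fun n => ∮ w in C(0, R), (w - z)⁻¹ • f n w) atTop
        (𝓝 (∮ w in C(0, R), (w - z)⁻¹ • F w)) := by
      refine intervalIntegral.tendsto_integral_filter_of_dominated_convergence
        (fun θ => ‖deriv (circleMap 0 R) θ‖ * (‖(circleMap 0 R θ - z)⁻¹‖ * M)) ?_ ?_ ?_ ?_
      · refine Eventually.of_forall fun n => Continuous.aestronglyMeasurable ?_
        have := (hf n).continuous
        simp only [deriv_circleMap]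
        fun_prop
      · filter_upwards [hM] with n hn
        refine Eventually.of_forall fun θ _ => ?_
        rw [norm_smul, norm_smul]
        gcongr
        exact hn _ (hcirc θ)
      · refine Continuous.intervalIntegrable ?_ _ _
        simp only [deriv_circleMap]
        fun_prop
      · exact Eventually.of_forall fun θ _ =>
          ((hlim (circleMap 0 R θ)).const_smul _).const_smul _
    have h3 := h2.const_smul (2 * Real.pi * Complex.I : ℂ)⁻¹
    simp only [h1] at h3
    exact tendsto_nhds_unique h3 (hlim z)
  have hps := hasFPowerSeriesOn_cauchy_integral hFint hRpos
  have hz₀ : z₀ ∈ Metric.ball (0 : ℂ) R := by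
    rw [mem_ball_zero_iff, hRr]; linarith
  have hd : DifferentiableAt ℂ (fun w => (2 * Real.pi * Complex.I : ℂ)⁻¹ •
      ∮ z in C(0, R), (z - w)⁻¹ • F z) z₀ := by
    refine (hps.analyticAt_of_mem ?_).differentiableAt
    rwa [Metric.eball_coe]
  refine hd.congr_of_eventuallyEq ?_
  filter_upwards [Metric.isOpen_ball.mem_nhds hz₀] with z hz
  exact (hcauchy z hz).symm

/-- Division of an entire function by another one whose zeros are simple and common. -/
theorem exists_entire_quotient {F G : ℂ → ℂ} (hF : Differentiable ℂ F) (hG : Differentiable ℂ G)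
    (h : ∀ z, G z = 0 → F z = 0 ∧ deriv G z ≠ 0) :
    ∃ q : ℂ → ℂ, Differentiable ℂ q ∧ ∀ z, F z = q z * G z := by
  classical
  set q : ℂ → ℂ := fun z => if G z = 0 then deriv F z / deriv G z else F z / G z with hq
  refine ⟨q, fun z₀ => ?_, fun z => ?_⟩
  · by_cases hz₀ : G z₀ = 0
    · obtain ⟨hF0, hG0⟩ := h z₀ hz₀
      have dF : Differentiable ℂ (dslope F z₀) := by
        rw [← differentiableOn_univ] at hF ⊢
        exact (Complex.differentiableOn_dslope univ_mem).2 hF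
      have dG : Differentiable ℂ (dslope G z₀) := by
        rw [← differentiableOn_univ] at hG ⊢
        exact (Complex.differentiableOn_dslope univ_mem).2 hG
      have hne : dslope G z₀ z₀ ≠ 0 := by rwa [dslope_same]
      refine ((dF z₀).div (dG z₀) hne).congr_of_eventuallyEq ?_
      filter_upwards [dG.continuous.continuousAt.eventually_ne hne] with z hz
      rcases eq_or_ne z z₀ with rfl | hzz
      · simp [hq, hz₀]
      · have hsF : F z = (z - z₀) * dslope F z₀ z := by
          rw [dslope_of_ne _ hzz, slope_def_field, hF0, sub_zero]
          field_simp [sub_ne_zero.2 hzz]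
        have hsG : G z = (z - z₀) * dslope G z₀ z := by
          rw [dslope_of_ne _ hzz, slope_def_field, hz₀, sub_zero]
          field_simp [sub_ne_zero.2 hzz]
        have hGz : G z ≠ 0 := by
          rw [hsG]
          exact mul_ne_zero (sub_ne_zero.2 hzz) hz
        simp only [hq, if_neg hGz, Pi.div_apply]
        rw [hsF, hsG, mul_div_mul_left _ _ (sub_ne_zero.2 hzz)]
    · refine ((hF z₀).div (hG z₀) hz₀).congr_of_eventuallyEq ?_
      filter_upwards [hG.continuous.continuousAt.eventually_ne hz₀] with z hz
      simp [hq, hz]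
  · by_cases hz : G z = 0
    · rw [hz, mul_zero, (h z hz).1]
    · simp only [hq, if_neg hz]
      field_simp

/-- A zero-free entire function `q` with `log |q(z)| ≤ o(|z|²)` is the exponential of a polynomial
of degree at most one. -/
theorem exists_eq_exp_linear {q : ℂ → ℂ} (hq : Differentiable ℂ q) (hq0 : ∀ z, q z ≠ 0)
    (hgrowth : ∀ ε : ℝ, 0 < ε → ∃ C : ℝ, ∀ z, ‖q z‖ ≤ C * Real.exp (ε * ‖z‖ ^ 2)) :
    ∃ p₀ p₁ : ℂ, ∀ z, q z = Complex.exp (p₀ + p₁ * z) := by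
  obtain ⟨g, hg0, hg⟩ := (((hq.deriv).div hq hq0).isExactOn_univ).with_val_at 0 (Complex.log (q 0))
  have hgd : Differentiable ℂ g := fun z => (hg z (Set.mem_univ z)).differentiableAt
  have hqg : ∀ z, q z = Complex.exp (g z) := by
    have hconst : ∀ z, q z * Complex.exp (-g z) = q 0 * Complex.exp (-g 0) := by
      intro z
      refine is_const_of_deriv_eq_zero (f := fun z => q z * Complex.exp (-g z))
        (by fun_prop) (fun w => ?_) z 0
      have h1 : HasDerivAt (fun z => q z * Complex.exp (-g z))
          (deriv q w * Complex.exp (-g w) + q w * (Complex.exp (-g w) * -(deriv q w / q w))) w :=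
        (hq w).hasDerivAt.mul (hg w (Set.mem_univ w)).fun_neg.cexp
      rw [h1.deriv]
      field_simp [hq0 w]
      ring
    intro z
    have h1 := hconst z
    rw [hg0, Complex.exp_neg, Complex.exp_neg, Complex.exp_log (hq0 0),
      mul_inv_cancel₀ (hq0 0)] at h1
    exact eq_of_mul_inv_eq_one h1
  have hre : ∀ ε : ℝ, 0 < ε → ∃ C : ℝ, 0 ≤ C ∧ ∀ z, (g z).re ≤ C + ε * ‖z‖ ^ 2 := by
    intro ε hε
    obtain ⟨C, hC⟩ := hgrowth ε hε
    have hCpos : 0 < C := by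
      have h1 := hC 0
      have h2 := norm_pos_iff.2 (hq0 0)
      by_contra hneg
      have : C * Real.exp (ε * ‖(0 : ℂ)‖ ^ 2) ≤ 0 :=
        mul_nonpos_of_nonpos_of_nonneg (not_lt.1 hneg) (Real.exp_pos _).le
      linarith
    refine ⟨|Real.log C|, abs_nonneg _, fun z => ?_⟩
    have h1 := hC z
    rw [hqg z, Complex.norm_exp, ← Real.exp_log hCpos, ← Real.exp_add, Real.exp_le_exp] at h1
    linarith [le_abs_self (Real.log C)]
  have hd2 : ∀ c, iteratedDeriv 2 g c = 0 := by
    intro c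
    rw [← norm_le_zero_iff]
    refine le_of_forall_pos_le_add fun δ hδ => ?_
    obtain ⟨C, hC0, hC⟩ := hre (δ / 256) (by positivity)
    set D := 2 * (C + 1) + 3 * ‖g 0‖ with hD
    have hD0 : 0 < D := by positivity
    set R := max (‖c‖ + 1) (4 * D / δ + 1) with hR
    have hR1 : ‖c‖ + 1 ≤ R := le_max_left _ _
    have hR2 : 4 * D / δ + 1 ≤ R := le_max_right _ _
    have hR0 : 1 ≤ R := by linarith [norm_nonneg c]
    have hM : (0 : ℝ) < C + 1 + δ / 256 * (4 * R) ^ 2 := by positivity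
    have h1 : ∀ w ∈ Metric.sphere c R,
        ‖g w‖ ≤ 2 * (C + 1 + δ / 256 * (4 * R) ^ 2) + ‖g 0‖ * 3 := by
      intro w hw
      have hw2 : ‖w‖ ≤ 2 * R := by
        have h2 := norm_le_norm_add_norm_sub' w c
        rw [mem_sphere_iff_norm] at hw
        linarith
      have h3 := Complex.borelCaratheodory (f := g) (R := 4 * R) hM hgd.differentiableOn
        (fun z hz => by
          rw [mem_ball_zero_iff] at hz
          have h4 := hC z
          have h5 : ‖z‖ ^ 2 ≤ (4 * R) ^ 2 := pow_le_pow_left₀ (norm_nonneg _) hz.le 2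
          change (g z).re ≤ _
          have : δ / 256 * ‖z‖ ^ 2 ≤ δ / 256 * (4 * R) ^ 2 := by gcongr
          linarith) (by positivity) (z := w) (by rw [mem_ball_zero_iff]; linarith)
      have hden : 2 * R ≤ 4 * R - ‖w‖ := by linarith
      have hdpos : 0 < 4 * R - ‖w‖ := by linarith
      refine h3.trans (add_le_add ?_ ?_)
      · rw [div_le_iff₀ hdpos]
        exact mul_le_mul_of_nonneg_left (by linarith) (by positivity)
      · rw [div_le_iff₀ hdpos, mul_assoc]
        exact mul_le_mul_of_nonneg_left (by linarith) (norm_nonneg _)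
    have h2 := Complex.norm_iteratedDeriv_le_of_forall_mem_sphere_norm_le 2 (by linarith : 0 < R)
      hgd.diffContOnCl h1
    refine h2.trans ?_
    rw [zero_add, div_le_iff₀ (by positivity)]
    have h5 : 4 * D ≤ δ * R := by
      have : 4 * D / δ ≤ R := by linarith
      rw [div_le_iff₀ hδ] at this
      linarith
    have h6 : δ * R ≤ δ * R ^ 2 := by
      have : R ≤ R ^ 2 := by nlinarith
      gcongr
    have : ((Nat.factorial 2 : ℕ) : ℝ) = 2 := by norm_num [Nat.factorial]
    rw [this]
    nlinarith
  have hd1 : ∀ z, deriv g z = deriv g 0 := by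
    intro z
    refine is_const_of_deriv_eq_zero hgd.deriv (fun w => ?_) z 0
    have := hd2 w
    rwa [iteratedDeriv_succ, iteratedDeriv_one] at this
  refine ⟨g 0, deriv g 0, fun z => ?_⟩
  have h1 := is_const_of_deriv_eq_zero (f := fun z => g z - deriv g 0 * z) (by fun_prop)
    (fun w => by
      have h2 : HasDerivAt (fun z => g z - deriv g 0 * z) (deriv g w - deriv g 0 * 1) w :=
        (hgd w).hasDerivAt.sub ((hasDerivAt_id w).const_mul _)
      rw [h2.deriv, hd1 w]; ring) z 0
  simp only [mul_zero, sub_zero] at h1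
  rw [hqg z, ← h1]
  congr 1
  ring

/-- The coefficient `1 / a²` of the quadratic estimates for the factor `1 - z / a`, and `1` for the
factor `z`. -/
noncomputable def recipSq (a : ℝ) : ℝ := if a = 0 then 1 else (a ^ 2)⁻¹

theorem recipSq_nonneg (a : ℝ) : 0 ≤ recipSq a := by
  rw [recipSq]; split_ifs <;> positivity

theorem canonicalFactor_zero (z : ℂ) : canonicalFactor 0 z = z := if_pos rfl

theorem canonicalFactor_of_ne {a : ℝ} (ha : a ≠ 0) (z : ℂ) :
    canonicalFactor a z = 1 - z / a := if_neg ha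

theorem canonicalFactor_self (a : ℝ) : canonicalFactor a a = 0 := by
  rcases eq_or_ne a 0 with rfl | ha
  · simp [canonicalFactor_zero]
  · rw [canonicalFactor_of_ne ha, div_self (Complex.ofReal_ne_zero.2 ha), sub_self]

theorem norm_canonicalFactor (a : ℝ) (z : ℂ) :
    ‖canonicalFactor a z‖ = (if a = 0 then 1 else |a|⁻¹) * ‖z - a‖ := by
  rcases eq_or_ne a 0 with rfl | ha
  · simp [canonicalFactor_zero]
  · have ha' := Complex.ofReal_ne_zero.2 ha
    rw [canonicalFactor_of_ne ha, if_neg ha,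
      show (1 : ℂ) - z / a = -((a : ℂ)⁻¹ * (z - a)) by field_simp; ring, norm_neg, norm_mul,
      norm_inv, Complex.norm_real, Real.norm_eq_abs]

theorem canonicalFactor_eq_zero_iff {a : ℝ} {z : ℂ} : canonicalFactor a z = 0 ↔ z = a := by
  rw [← norm_eq_zero, norm_canonicalFactor, mul_eq_zero, norm_eq_zero, sub_eq_zero]
  refine or_iff_right ?_
  split_ifs with h
  · exact one_ne_zero
  · exact inv_ne_zero (abs_ne_zero.2 h)

theorem differentiable_canonicalFactor (a : ℝ) : Differentiable ℂ (canonicalFactor a) := by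
  rcases eq_or_ne a 0 with rfl | ha
  · have : canonicalFactor 0 = fun z => z := funext canonicalFactor_zero
    rw [this]; exact differentiable_id
  · have : canonicalFactor a = fun z : ℂ => 1 - z / a := funext (canonicalFactor_of_ne ha)
    rw [this]; fun_prop

theorem norm_one_sub_div_sq {a : ℝ} (ha : a ≠ 0) (z : ℂ) :
    ‖1 - z / a‖ ^ 2 = 1 - 2 * z.re * a⁻¹ + ‖z‖ ^ 2 * (a ^ 2)⁻¹ := by
  rw [Complex.sq_norm, Complex.sq_norm, Complex.normSq_apply, Complex.normSq_apply]
  simp only [Complex.sub_re, Complex.one_re, Complex.div_ofReal_re, Complex.sub_im,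
    Complex.one_im, Complex.div_ofReal_im]
  field_simp
  ring

theorem norm_canonicalFactor_sq_le (a : ℝ) (z : ℂ) :
    ‖canonicalFactor a z‖ ^ 2 ≤ Real.exp (-(2 * z.re * a⁻¹) + ‖z‖ ^ 2 * recipSq a) := by
  rcases eq_or_ne a 0 with rfl | ha
  · rw [canonicalFactor_zero, recipSq, if_pos rfl, inv_zero, mul_zero, neg_zero, zero_add, mul_one]
    linarith [Real.add_one_le_exp (‖z‖ ^ 2)]
  · rw [canonicalFactor_of_ne ha, norm_one_sub_div_sq ha, recipSq, if_neg ha]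
    have := Real.add_one_le_exp (-(2 * z.re * a⁻¹) + ‖z‖ ^ 2 * (a ^ 2)⁻¹)
    linarith

theorem exp_le_norm_canonicalFactor {a : ℝ} (ha : a ≠ 0) {z : ℂ} (hz : 2 * ‖z‖ ≤ |a|) :
    Real.exp (-(z.re * a⁻¹) - ‖z‖ ^ 2 * recipSq a) ≤ ‖canonicalFactor a z‖ := by
  have hapos : 0 < |a| := abs_pos.2 ha
  set t : ℂ := -(z / a) with ht
  have htn : ‖t‖ = ‖z‖ / |a| := by
    rw [ht, norm_neg, norm_div, Complex.norm_real, Real.norm_eq_abs]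
  have ht2 : ‖t‖ ≤ 1 / 2 := by
    rw [htn, div_le_iff₀ hapos]; linarith
  have hlog := Complex.norm_log_one_add_sub_self_le (z := t) (by linarith)
  have hinv : (1 - ‖t‖)⁻¹ ≤ 2 := by
    rw [inv_le_comm₀ (by linarith) two_pos]; linarith
  have hlog2 : ‖Complex.log (1 + t) - t‖ ≤ ‖t‖ ^ 2 := by
    refine hlog.trans ?_
    have : ‖t‖ ^ 2 * (1 - ‖t‖)⁻¹ ≤ ‖t‖ ^ 2 * 2 := by gcongr
    linarith
  have hne : 1 + t ≠ 0 := by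
    intro h0
    have : t = -1 := by linear_combination h0
    rw [this, norm_neg, norm_one] at ht2
    norm_num at ht2
  have h1 : canonicalFactor a z = Complex.exp (Complex.log (1 + t)) := by
    rw [Complex.exp_log hne, canonicalFactor_of_ne ha, ht]; ring
  rw [h1, Complex.norm_exp, Real.exp_le_exp]
  have h2 : |(Complex.log (1 + t) - t).re| ≤ ‖t‖ ^ 2 := (Complex.abs_re_le_norm _).trans hlog2
  have h3 : t.re = -(z.re * a⁻¹) := by
    rw [ht, Complex.neg_re, Complex.div_ofReal_re, div_eq_mul_inv]
  have h4 : ‖t‖ ^ 2 = ‖z‖ ^ 2 * recipSq a := by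
    rw [htn, recipSq, if_neg ha, div_pow, sq_abs, div_eq_mul_inv]
  rw [Complex.sub_re, abs_le, h3, h4] at h2
  linarith [h2.1]

theorem norm_prod_canonicalFactor_sq_le (s : Finset ℝ) (z : ℂ) :
    ‖∏ a ∈ s, canonicalFactor a z‖ ^ 2 ≤
      Real.exp (-(2 * z.re * ∑ a ∈ s, a⁻¹) + ‖z‖ ^ 2 * ∑ a ∈ s, recipSq a) := by
  rw [norm_prod, ← Finset.prod_pow, Finset.mul_sum, Finset.mul_sum, ← Finset.sum_neg_distrib,
    ← Finset.sum_add_distrib, Real.exp_sum]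
  exact Finset.prod_le_prod (fun _ _ => by positivity) fun a _ => norm_canonicalFactor_sq_le a z

theorem exp_le_norm_prod_canonicalFactor {s : Finset ℝ} {z : ℂ}
    (hs : ∀ a ∈ s, a ≠ 0 ∧ 2 * ‖z‖ ≤ |a|) :
    Real.exp (-(z.re * ∑ a ∈ s, a⁻¹) - ‖z‖ ^ 2 * ∑ a ∈ s, recipSq a) ≤
      ‖∏ a ∈ s, canonicalFactor a z‖ := by
  rw [norm_prod, Finset.mul_sum, Finset.mul_sum, ← Finset.sum_neg_distrib,
    ← Finset.sum_sub_distrib, Real.exp_sum]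
  exact Finset.prod_le_prod (fun _ _ => (Real.exp_pos _).le) fun a ha =>
    exp_le_norm_canonicalFactor (hs a ha).1 (hs a ha).2

theorem one_le_norm_prod_mul_prod_neg (s : Finset ℝ) :
    1 ≤ ‖∏ a ∈ s, canonicalFactor a (1 + Complex.I)‖ *
      ‖∏ a ∈ s, canonicalFactor a (-(1 + Complex.I))‖ := by
  rw [← norm_mul, ← Finset.prod_mul_distrib, norm_prod]
  refine Finset.one_le_prod fun a _ => ?_
  have hI : (1 + Complex.I) * (1 + Complex.I) = 2 * Complex.I := by
    linear_combination Complex.I_mul_I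
  rcases eq_or_ne a 0 with rfl | ha
  · rw [canonicalFactor_zero, canonicalFactor_zero, mul_neg, hI]
    simp
  · have ha' := Complex.ofReal_ne_zero.2 ha
    rw [canonicalFactor_of_ne ha, canonicalFactor_of_ne ha]
    have h1 : (1 - (1 + Complex.I) / a) * (1 - -(1 + Complex.I) / (a : ℂ)) =
        1 - 2 * Complex.I / (a ^ 2 : ℝ) := by
      push_cast
      field_simp
      linear_combination (-1 : ℂ) * hI
    rw [h1]
    refine le_trans ?_ (Complex.abs_re_le_norm _)
    rw [Complex.sub_re, Complex.div_ofReal_re]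
    simp

theorem one_add_le_exp_mul {ε x : ℝ} (hε : 0 < ε) (hx : 0 ≤ x) :
    1 + x ≤ (1 + ε⁻¹) * Real.exp (ε * x) := by
  have h1 := Real.add_one_le_exp (ε * x)
  have h2 : (1 + ε⁻¹) * (ε * x + 1) ≤ (1 + ε⁻¹) * Real.exp (ε * x) := by gcongr
  have h3 : (1 + ε⁻¹) * (ε * x + 1) = ε * x + 1 + x + ε⁻¹ := by field_simp; ring
  have : 0 ≤ ε * x := by positivity
  have : 0 ≤ ε⁻¹ := by positivity
  linarith

/-- A finite product of canonical factors grows slower than any exponential. -/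
theorem exists_norm_prod_canonicalFactor_le (s : Finset ℝ) {ε : ℝ} (hε : 0 < ε) :
    ∃ C : ℝ, 0 ≤ C ∧ ∀ z, ‖∏ a ∈ s, canonicalFactor a z‖ ≤ C * Real.exp (ε * ‖z‖) := by
  classical
  induction s using Finset.induction_on generalizing ε with
  | empty =>
    refine ⟨1, zero_le_one, fun z => ?_⟩
    rw [Finset.prod_empty, norm_one, one_mul]
    exact Real.one_le_exp (by positivity)
  | insert a s ha ih =>
    obtain ⟨C, hC0, hC⟩ := ih (half_pos hε)
    refine ⟨(1 + |a|⁻¹) * (1 + (ε / 2)⁻¹) * C, by positivity, fun z => ?_⟩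
    rw [Finset.prod_insert ha, norm_mul]
    have h1 : ‖canonicalFactor a z‖ ≤ (1 + |a|⁻¹) * (1 + ‖z‖) := by
      have hinv : 0 ≤ |a|⁻¹ := by positivity
      have hz := norm_nonneg z
      rcases eq_or_ne a 0 with rfl | ha0
      · rw [canonicalFactor_zero]; nlinarith
      · rw [canonicalFactor_of_ne ha0]
        refine (norm_sub_le _ _).trans ?_
        rw [norm_one, norm_div, Complex.norm_real, Real.norm_eq_abs, div_eq_mul_inv]
        nlinarith
    have h2 := one_add_le_exp_mul (half_pos hε) (norm_nonneg z)
    calc ‖canonicalFactor a z‖ * ‖∏ a ∈ s, canonicalFactor a z‖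
        ≤ ((1 + |a|⁻¹) * ((1 + (ε / 2)⁻¹) * Real.exp (ε / 2 * ‖z‖))) *
          (C * Real.exp (ε / 2 * ‖z‖)) := by
          refine mul_le_mul (h1.trans ?_) (hC z) (norm_nonneg _) (by positivity)
          gcongr
      _ = (1 + |a|⁻¹) * (1 + (ε / 2)⁻¹) * C *
          (Real.exp (ε / 2 * ‖z‖) * Real.exp (ε / 2 * ‖z‖)) := by ring
      _ = _ := by
          rw [← Real.exp_add]; ring_nf

/-- The tails of a summable nonnegative series over a set are uniformly small. -/
theorem exists_finset_tail_lt {Z : Set ℝ} {f : ℝ → ℝ}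
    (hf : Summable fun a : Z => f a) {ε : ℝ} (hε : 0 < ε) :
    ∃ T : Finset ℝ, (T : Set ℝ) ⊆ Z ∧ ∀ s : Finset ℝ, (s : Set ℝ) ⊆ Z → Disjoint s T →
      ∑ a ∈ s, f a < ε := by
  classical
  obtain ⟨T, hT⟩ := summable_iff_vanishing_norm.1 hf ε hε
  refine ⟨T.map (Function.Embedding.subtype _), ?_, fun s hs hd => ?_⟩
  · intro x hx
    obtain ⟨y, -, rfl⟩ := Finset.mem_map.1 hx
    exact y.2
  · have h1 := hT (s.subtype (· ∈ Z)) ?_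
    · have h2 : ∑ a ∈ s.subtype (· ∈ Z), f a = ∑ a ∈ s, f a :=
        Finset.sum_subtype_of_mem f fun x hx => hs hx
      rw [h2] at h1
      exact lt_of_abs_lt h1
    · rw [Finset.disjoint_left] at hd ⊢
      intro x hx hxT
      exact hd (Finset.mem_subtype.1 hx) (Finset.mem_map.2 ⟨x, hxT, rfl⟩)

theorem sum_le_tsum_subtype {Z : Set ℝ} {f : ℝ → ℝ} (hf0 : ∀ a, 0 ≤ f a)
    (hf : Summable fun a : Z => f a) {s : Finset ℝ} (hs : (s : Set ℝ) ⊆ Z) :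
    ∑ a ∈ s, f a ≤ ∑' a : Z, f a := by
  classical
  have h2 : ∑ a ∈ s.subtype (· ∈ Z), f a = ∑ a ∈ s, f a :=
    Finset.sum_subtype_of_mem f fun x hx => hs hx
  rw [← h2]
  exact hf.sum_le_tsum _ fun a _ => hf0 a

/-- `F` is the limit of the canonical products over an exhausting sequence of finite subsets of
`Z`, where `∑ 1 / a²` converges over `Z`. -/
structure IsCanonicalLimit (Z : Set ℝ) (S : ℕ → Finset ℝ) (F : ℂ → ℂ) : Prop where
  subset : ∀ n, (S n : Set ℝ) ⊆ Z
  eventually_subset : ∀ T : Finset ℝ, (T : Set ℝ) ⊆ Z → ∀ᶠ n in atTop, T ⊆ S n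
  tendsto : ∀ z, Tendsto (fun n => ∏ a ∈ S n, canonicalFactor a z) atTop (𝓝 (F z))
  finite : ∀ R : ℝ, {a ∈ Z | |a| < R}.Finite
  summable : Summable fun a : Z => recipSq a

theorem IsGeneratingFunction.exists_isCanonicalLimit {Z : Set ℝ} {F : ℂ → ℂ}
    (h : IsGeneratingFunction Z F) (hs : Summable fun a : Z => recipSq a) :
    ∃ S, IsCanonicalLimit Z S F := by
  obtain ⟨hfin, hlim⟩ := h
  refine ⟨fun n => (hfin n).toFinset, fun n a ha => ?_, fun T hT => ?_, fun z => ?_, hfin, hs⟩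
  · exact ((hfin n).mem_toFinset.1 ha).1
  · obtain ⟨R, hR⟩ : ∃ R : ℝ, ∀ a ∈ T, |a| < R :=
      ⟨∑ a ∈ T, |a| + 1, fun a ha => by
        linarith [Finset.single_le_sum (f := fun a : ℝ => |a|) (fun _ _ => abs_nonneg _) ha]⟩
    filter_upwards [eventually_ge_atTop ⌈R⌉₊] with n hn a ha
    exact (hfin n).mem_toFinset.2 ⟨hT ha, (hR a ha).trans_le (Nat.ceil_le.1 hn)⟩
  · have := (hlim z).comp tendsto_natCast_atTop_atTop
    refine this.congr fun n => ?_
    exact finprod_mem_eq_finite_toFinset_prod _ (hfin n)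

namespace IsCanonicalLimit

variable {Z : Set ℝ} {S : ℕ → Finset ℝ} {F : ℂ → ℂ}

/-- The principal value sums of `1 / a` are bounded. -/
theorem exists_abs_sum_inv_le (h : IsCanonicalLimit Z S F) :
    ∃ A : ℝ, 0 ≤ A ∧ ∀ᶠ n in atTop, |∑ a ∈ S n, a⁻¹| ≤ A := by
  set B := ∑' a : Z, recipSq a with hB
  set z₀ : ℂ := 1 + Complex.I with hz₀
  set M := max ‖F z₀‖ ‖F (-z₀)‖ + 1 with hM
  have hMpos : 0 < M := by
    have : 0 ≤ max ‖F z₀‖ ‖F (-z₀)‖ := le_max_of_le_left (norm_nonneg _)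
    linarith
  have hn2 : ‖z₀‖ ^ 2 = 2 := by
    rw [Complex.sq_norm, Complex.normSq_apply, hz₀]; norm_num
  have hre : z₀.re = 1 := by rw [hz₀]; simp
  refine ⟨B + |Real.log M|, add_nonneg (tsum_nonneg fun a => recipSq_nonneg _) (abs_nonneg _), ?_⟩
  have e1 : ∀ᶠ n in atTop, ‖∏ a ∈ S n, canonicalFactor a z₀‖ < M :=
    (h.tendsto z₀).norm.eventually (gt_mem_nhds (by
      linarith [le_max_left ‖F z₀‖ ‖F (-z₀)‖]))
  have e2 : ∀ᶠ n in atTop, ‖∏ a ∈ S n, canonicalFactor a (-z₀)‖ < M :=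
    (h.tendsto (-z₀)).norm.eventually (gt_mem_nhds (by
      linarith [le_max_right ‖F z₀‖ ‖F (-z₀)‖]))
  filter_upwards [e1, e2] with n h1 h2
  have h3 := one_le_norm_prod_mul_prod_neg (S n)
  rw [← hz₀] at h3
  have hsum := sum_le_tsum_subtype recipSq_nonneg h.summable (h.subset n)
  rw [← hB] at hsum
  have hlog := le_abs_self (Real.log M)
  have gen : ∀ p x A : ℝ, 0 ≤ p → 0 ≤ x → x < M → 1 ≤ p * x →
      p ^ 2 ≤ Real.exp (A + 2 * ∑ a ∈ S n, recipSq a) → -A ≤ 2 * (B + |Real.log M|) := by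
    intro p x A hp hx0 hx hpx hp2
    have h4 : 1 ≤ p * M := hpx.trans (mul_le_mul_of_nonneg_left hx.le hp)
    have hppos : 0 < p := by
      by_contra hneg
      have : p * M ≤ 0 := mul_nonpos_of_nonpos_of_nonneg (not_lt.1 hneg) hMpos.le
      linarith
    have h5 : 0 ≤ Real.log p + Real.log M := by
      rw [← Real.log_mul hppos.ne' hMpos.ne']
      exact Real.log_nonneg h4
    have h6 := Real.log_le_log (by positivity) hp2
    rw [Real.log_exp, Real.log_pow] at h6
    push_cast at h6
    linarith
  have g1 := gen _ _ (-(2 * ∑ a ∈ S n, a⁻¹)) (norm_nonneg _) (norm_nonneg _) h2 h3 (by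
    have := norm_prod_canonicalFactor_sq_le (S n) z₀
    rwa [hn2, hre, mul_one] at this)
  have g2 := gen _ _ (2 * ∑ a ∈ S n, a⁻¹) (norm_nonneg _) (norm_nonneg _) h1
    (by rwa [mul_comm] at h3) (by
      have := norm_prod_canonicalFactor_sq_le (S n) (-z₀)
      rw [norm_neg, hn2, Complex.neg_re, hre] at this
      convert this using 3
      ring)
  rw [abs_le]
  constructor <;> linarith

/-- The partial products, and hence their limit, have growth `o(|z|²)` in the exponent, uniformly. -/
theorem exists_eventually_norm_prod_le (h : IsCanonicalLimit Z S F) {ε : ℝ} (hε : 0 < ε) :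
    ∃ C : ℝ, 0 ≤ C ∧ ∀ᶠ n in atTop, ∀ z,
      ‖∏ a ∈ S n, canonicalFactor a z‖ ≤ C * Real.exp (ε * ‖z‖ ^ 2) := by
  classical
  obtain ⟨T, hT, htail⟩ := exists_finset_tail_lt h.summable hε
  obtain ⟨A, hA0, hA⟩ := h.exists_abs_sum_inv_le
  obtain ⟨C, hC0, hC⟩ := exists_norm_prod_canonicalFactor_le T one_pos
  set D := A + |∑ a ∈ T, a⁻¹| with hD
  have hD0 : 0 ≤ D := by positivity
  refine ⟨C * Real.exp ((1 + D) ^ 2 / (2 * ε)), by positivity, ?_⟩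
  filter_upwards [hA, h.eventually_subset T hT] with n hn hTn z
  have hsplit : ∏ a ∈ S n, canonicalFactor a z =
      (∏ a ∈ S n \ T, canonicalFactor a z) * ∏ a ∈ T, canonicalFactor a z :=
    (Finset.prod_sdiff hTn).symm
  have hsum : ∑ a ∈ S n \ T, a⁻¹ = ∑ a ∈ S n, a⁻¹ - ∑ a ∈ T, a⁻¹ := by
    rw [← Finset.sum_sdiff hTn]; ring
  have habs : |∑ a ∈ S n \ T, a⁻¹| ≤ D := by
    rw [hsum]; exact (abs_sub _ _).trans (by linarith)
  have ht := htail (S n \ T)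
    (fun a ha => h.subset n (Finset.mem_sdiff.1 ha).1) Finset.sdiff_disjoint
  have h1 : ‖∏ a ∈ S n \ T, canonicalFactor a z‖ ≤
      Real.exp (D * ‖z‖ + ε / 2 * ‖z‖ ^ 2) := by
    refine le_of_sq_le_sq ?_ (Real.exp_pos _).le
    refine (norm_prod_canonicalFactor_sq_le _ z).trans ?_
    rw [← Real.exp_nat_mul, Real.exp_le_exp]
    have h2 : -(2 * z.re * ∑ a ∈ S n \ T, a⁻¹) ≤ 2 * (‖z‖ * D) := by
      have h3 : |z.re * ∑ a ∈ S n \ T, a⁻¹| ≤ ‖z‖ * D := by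
        rw [abs_mul]
        exact mul_le_mul (Complex.abs_re_le_norm z) habs (abs_nonneg _) (norm_nonneg _)
      have := neg_abs_le (z.re * ∑ a ∈ S n \ T, a⁻¹)
      linarith
    have h4 : ‖z‖ ^ 2 * ∑ a ∈ S n \ T, recipSq a ≤ ‖z‖ ^ 2 * ε := by gcongr
    push_cast
    linarith
  rw [hsplit, norm_mul]
  calc _ ≤ Real.exp (D * ‖z‖ + ε / 2 * ‖z‖ ^ 2) * (C * Real.exp (1 * ‖z‖)) :=
        mul_le_mul h1 (hC z) (norm_nonneg _) (Real.exp_pos _).le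
    _ = C * Real.exp ((1 + D) * ‖z‖ + ε / 2 * ‖z‖ ^ 2) := by
        rw [mul_left_comm, ← Real.exp_add]; ring_nf
    _ ≤ C * Real.exp ((1 + D) ^ 2 / (2 * ε) + ε * ‖z‖ ^ 2) := by
        refine mul_le_mul_of_nonneg_left (Real.exp_le_exp.2 ?_) hC0
        have h5 : (1 + D) * ‖z‖ ≤ (1 + D) ^ 2 / (2 * ε) + ε / 2 * ‖z‖ ^ 2 := by
          have h6 : (1 + D) ^ 2 / (2 * ε) + ε / 2 * ‖z‖ ^ 2 - (1 + D) * ‖z‖ =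
              ((1 + D) - ε * ‖z‖) ^ 2 / (2 * ε) := by
            field_simp; ring
          have h7 : 0 ≤ ((1 + D) - ε * ‖z‖) ^ 2 / (2 * ε) := by positivity
          linarith
        linarith
    _ = _ := by rw [Real.exp_add, mul_assoc]

theorem exists_norm_le (h : IsCanonicalLimit Z S F) {ε : ℝ} (hε : 0 < ε) :
    ∃ C : ℝ, 0 ≤ C ∧ ∀ z, ‖F z‖ ≤ C * Real.exp (ε * ‖z‖ ^ 2) := by
  obtain ⟨C, hC0, hC⟩ := h.exists_eventually_norm_prod_le hε
  exact ⟨C, hC0, fun z => le_of_tendsto (h.tendsto z).norm (hC.mono fun n hn => hn z)⟩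

theorem differentiable (h : IsCanonicalLimit Z S F) : Differentiable ℂ F := by
  refine differentiable_of_tendsto_of_bounded (f := fun n z => ∏ a ∈ S n, canonicalFactor a z)
    (fun n => Differentiable.fun_finsetProd fun a _ => differentiable_canonicalFactor a)
    h.tendsto fun r => ?_
  obtain ⟨C, hC0, hC⟩ := h.exists_eventually_norm_prod_le one_pos
  refine ⟨C * Real.exp (1 * r ^ 2), hC.mono fun n hn z hz => (hn z).trans ?_⟩
  gcongr

/-- On a disc, the limit is bounded below by a constant times a finite partial product. -/
theorem exists_mul_norm_prod_le (h : IsCanonicalLimit Z S F) (r : ℝ) :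
    ∃ (c : ℝ) (T : Finset ℝ), 0 < c ∧ (T : Set ℝ) ⊆ Z ∧
      ∀ z : ℂ, ‖z‖ ≤ r → c * ‖∏ a ∈ T, canonicalFactor a z‖ ≤ ‖F z‖ := by
  classical
  set T := (h.finite (2 * |r| + 1)).toFinset with hTdef
  have hT : (T : Set ℝ) ⊆ Z := fun a ha => ((h.finite _).mem_toFinset.1 ha).1
  obtain ⟨A, hA0, hA⟩ := h.exists_abs_sum_inv_le
  set B := ∑' a : Z, recipSq a with hB
  set D := A + |∑ a ∈ T, a⁻¹| with hD
  have hD0 : 0 ≤ D := by positivity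
  refine ⟨Real.exp (-(|r| * D) - |r| ^ 2 * B), T, Real.exp_pos _, hT, fun z hz => ?_⟩
  have hzr : ‖z‖ ≤ |r| := hz.trans (le_abs_self r)
  refine ge_of_tendsto (h.tendsto z).norm ?_
  filter_upwards [hA, h.eventually_subset T hT] with n hn hTn
  have hsplit : ∏ a ∈ S n, canonicalFactor a z =
      (∏ a ∈ S n \ T, canonicalFactor a z) * ∏ a ∈ T, canonicalFactor a z :=
    (Finset.prod_sdiff hTn).symm
  have hsum : ∑ a ∈ S n \ T, a⁻¹ = ∑ a ∈ S n, a⁻¹ - ∑ a ∈ T, a⁻¹ := by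
    rw [← Finset.sum_sdiff hTn]; ring
  have habs : |∑ a ∈ S n \ T, a⁻¹| ≤ D := by
    rw [hsum]; exact (abs_sub _ _).trans (by linarith)
  have hsub : ((S n \ T : Finset ℝ) : Set ℝ) ⊆ Z :=
    fun a ha => h.subset n (Finset.mem_sdiff.1 ha).1
  have hlow := exp_le_norm_prod_canonicalFactor (s := S n \ T) (z := z) fun a ha => by
    have h1 : 2 * |r| + 1 ≤ |a| := by
      by_contra hlt
      exact (Finset.mem_sdiff.1 ha).2
        ((h.finite _).mem_toFinset.2 ⟨hsub ha, not_le.1 hlt⟩)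
    refine ⟨?_, by linarith⟩
    rintro rfl
    rw [abs_zero] at h1
    linarith [abs_nonneg r]
  rw [hsplit, norm_mul]
  refine mul_le_mul_of_nonneg_right (le_trans ?_ hlow) (norm_nonneg _)
  rw [Real.exp_le_exp]
  have h2 : z.re * ∑ a ∈ S n \ T, a⁻¹ ≤ |r| * D := by
    refine (le_abs_self _).trans ?_
    rw [abs_mul]
    exact mul_le_mul ((Complex.abs_re_le_norm z).trans hzr) habs (abs_nonneg _) (abs_nonneg _)
  have h3 : ‖z‖ ^ 2 * ∑ a ∈ S n \ T, recipSq a ≤ |r| ^ 2 * B := by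
    have h4 := sum_le_tsum_subtype recipSq_nonneg h.summable hsub
    have h5 : 0 ≤ ∑ a ∈ S n \ T, recipSq a := Finset.sum_nonneg fun a _ => recipSq_nonneg a
    gcongr
  linarith

theorem eq_zero (h : IsCanonicalLimit Z S F) {a : ℝ} (ha : a ∈ Z) : F a = 0 := by
  refine tendsto_nhds_unique (h.tendsto a) (tendsto_const_nhds.congr' ?_)
  filter_upwards [h.eventually_subset {a} (by simpa using ha)] with n hn
  exact (Finset.prod_eq_zero (hn (Finset.mem_singleton_self a)) (canonicalFactor_self a)).symm

theorem ne_zero (h : IsCanonicalLimit Z S F) {z : ℂ} (hz : ∀ a ∈ Z, z ≠ (a : ℝ)) : F z ≠ 0 := by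
  obtain ⟨c, T, hc, hT, hle⟩ := h.exists_mul_norm_prod_le ‖z‖
  have h1 : ∏ a ∈ T, canonicalFactor a z ≠ 0 :=
    Finset.prod_ne_zero_iff.2 fun a ha h0 => hz a (hT ha) (canonicalFactor_eq_zero_iff.1 h0)
  have := hle z le_rfl
  exact norm_pos_iff.1 ((mul_pos hc (norm_pos_iff.2 h1)).trans_le this)

theorem deriv_ne_zero (h : IsCanonicalLimit Z S F) {a : ℝ} (ha : a ∈ Z) : deriv F a ≠ 0 := by
  classical
  obtain ⟨c, T, hc, hT, hle⟩ := h.exists_mul_norm_prod_le (|a| + 1)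
  set P : ℂ → ℂ := fun z => ∏ b ∈ T.erase a, canonicalFactor b z with hP
  have hPa : P a ≠ 0 := Finset.prod_ne_zero_iff.2 fun b hb h0 =>
    (Finset.mem_erase.1 hb).1 (Complex.ofReal_injective (canonicalFactor_eq_zero_iff.1 h0)).symm
  have hPc : Continuous P := (Differentiable.fun_finsetProd fun b _ =>
    differentiable_canonicalFactor b).continuous
  set k : ℝ := if a = 0 then 1 else |a|⁻¹ with hk
  have hkpos : 0 < k := by
    rw [hk]; split_ifs with h0
    · exact one_pos
    · exact inv_pos.2 (abs_pos.2 h0)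
  have haT : a ∈ T := by
    by_contra hna
    have h1 := hle a (by rw [Complex.norm_real, Real.norm_eq_abs]; linarith)
    rw [h.eq_zero ha, norm_zero, ← Finset.erase_eq_of_notMem hna] at h1
    exact absurd h1 (not_le.2 (mul_pos hc (norm_pos_iff.2 hPa)))
  have hslope := hasDerivAt_iff_tendsto_slope.1 (h.differentiable (a : ℂ)).hasDerivAt
  have hlim : Tendsto (fun z => c * (k * ‖P z‖)) (𝓝[≠] (a : ℂ)) (𝓝 (c * (k * ‖P a‖))) :=
    ((hPc.tendsto (a : ℂ)).norm.const_mul _ |>.const_mul _).mono_left nhdsWithin_le_nhds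
  have hle2 : c * (k * ‖P a‖) ≤ ‖deriv F a‖ := by
    refine le_of_tendsto_of_tendsto hlim hslope.norm ?_
    have hball : Metric.ball (a : ℂ) 1 ∈ 𝓝[≠] (a : ℂ) :=
      mem_nhdsWithin_of_mem_nhds (Metric.ball_mem_nhds _ one_pos)
    filter_upwards [hball, self_mem_nhdsWithin] with z hz hza
    have hzn : ‖z‖ ≤ |a| + 1 := by
      rw [Metric.mem_ball, dist_eq_norm] at hz
      have := norm_le_norm_add_norm_sub' z (a : ℂ)
      rw [Complex.norm_real, Real.norm_eq_abs] at this
      linarith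
    have hpos : 0 < ‖z - a‖ := norm_pos_iff.2 (sub_ne_zero.2 hza)
    rw [slope_def_field, h.eq_zero ha, sub_zero, norm_div, le_div_iff₀ hpos]
    refine le_trans (le_of_eq ?_) (hle z hzn)
    rw [← Finset.mul_prod_erase T _ haT, norm_mul, norm_canonicalFactor]
    ring
  exact norm_pos_iff.1 ((mul_pos hc (mul_pos hkpos (norm_pos_iff.2 hPa))).trans_le hle2)

/-- If all but finitely many elements of `Z` lie on one side of the origin, the canonical product
has exponential type zero. -/
theorem exists_norm_le_of_one_sided (h : IsCanonicalLimit Z S F) {σ : ℝ}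
    {T₀ : Finset ℝ} (hσ : ∀ a ∈ Z, a ∉ T₀ → σ * a⁻¹ = |a|⁻¹) (hσ1 : |σ| ≤ 1)
    (hT₀ : (T₀ : Set ℝ) ⊆ Z) {ε : ℝ} (hε : 0 < ε) :
    ∃ C : ℝ, 0 ≤ C ∧ ∀ z, ‖F z‖ ≤ C * Real.exp (ε * ‖z‖) := by
  classical
  obtain ⟨A, hA0, hA⟩ := h.exists_abs_sum_inv_le
  set M := A + |∑ a ∈ T₀, a⁻¹| + ∑ a ∈ T₀, |a|⁻¹ with hM
  have hbound : ∀ s : Finset ℝ, (s : Set ℝ) ⊆ Z → ∑ a ∈ s, |a|⁻¹ ≤ M := by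
    intro s hs
    obtain ⟨n, hn, hsn, hTn⟩ :=
      (hA.and ((h.eventually_subset s hs).and (h.eventually_subset T₀ hT₀))).exists
    have h1 : ∑ a ∈ s, |a|⁻¹ ≤ ∑ a ∈ S n, |a|⁻¹ :=
      Finset.sum_le_sum_of_subset_of_nonneg hsn fun a _ _ => by positivity
    have h2 : ∑ a ∈ S n \ T₀, |a|⁻¹ = σ * ∑ a ∈ S n \ T₀, a⁻¹ := by
      rw [Finset.mul_sum]
      exact Finset.sum_congr rfl fun a ha =>
        (hσ a (h.subset n (Finset.mem_sdiff.1 ha).1) (Finset.mem_sdiff.1 ha).2).symm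
    have h3 : ∑ a ∈ S n \ T₀, a⁻¹ = ∑ a ∈ S n, a⁻¹ - ∑ a ∈ T₀, a⁻¹ := by
      rw [← Finset.sum_sdiff hTn]; ring
    have h4 : σ * ∑ a ∈ S n \ T₀, a⁻¹ ≤ A + |∑ a ∈ T₀, a⁻¹| := by
      refine (le_abs_self _).trans ?_
      rw [abs_mul]
      refine (mul_le_of_le_one_left (abs_nonneg _) hσ1).trans ?_
      rw [h3]
      exact (abs_sub _ _).trans (by linarith)
    rw [← Finset.sum_sdiff hTn, h2] at h1
    linarith
  have hsum : Summable fun a : Z => |(a : ℝ)|⁻¹ := by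
    refine summable_of_sum_le (fun a => by positivity) (c := M) fun u => ?_
    have := hbound (u.map (Function.Embedding.subtype _)) (by
      intro x hx
      obtain ⟨y, -, rfl⟩ := Finset.mem_map.1 hx
      exact y.2)
    rwa [Finset.sum_map] at this
  obtain ⟨T₁, hT₁, htail⟩ := exists_finset_tail_lt (f := fun a => |a|⁻¹) hsum (half_pos hε)
  set T := T₁ ∪ (h.finite 1).toFinset with hTdef
  have hT : (T : Set ℝ) ⊆ Z := by
    intro a ha
    rcases Finset.mem_union.1 ha with h1 | h1
    · exact hT₁ h1
    · exact ((h.finite 1).mem_toFinset.1 h1).1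
  obtain ⟨C, hC0, hC⟩ := exists_norm_prod_canonicalFactor_le T (half_pos hε)
  refine ⟨C, hC0, fun z => le_of_tendsto (h.tendsto z).norm ?_⟩
  filter_upwards [h.eventually_subset T hT] with n hTn
  rw [← Finset.prod_sdiff hTn, norm_mul]
  have hsub : ((S n \ T : Finset ℝ) : Set ℝ) ⊆ Z :=
    fun a ha => h.subset n (Finset.mem_sdiff.1 ha).1
  have h1 : ‖∏ a ∈ S n \ T, canonicalFactor a z‖ ≤ Real.exp (ε / 2 * ‖z‖) := by
    have h2 : ‖∏ a ∈ S n \ T, canonicalFactor a z‖ ≤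
        ∏ a ∈ S n \ T, Real.exp (|a|⁻¹ * ‖z‖) := by
      rw [norm_prod]
      refine Finset.prod_le_prod (fun _ _ => norm_nonneg _) fun a ha => ?_
      have ha0 : a ≠ 0 := by
        rintro rfl
        refine (Finset.mem_sdiff.1 ha).2 (Finset.mem_union_right _ ?_)
        exact (h.finite 1).mem_toFinset.2 ⟨hsub ha, by simp⟩
      rw [canonicalFactor_of_ne ha0]
      refine (norm_sub_le _ _).trans ?_
      rw [norm_one, norm_div, Complex.norm_real, Real.norm_eq_abs, div_eq_inv_mul, add_comm]
      exact Real.add_one_le_exp _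
    refine h2.trans ?_
    rw [← Real.exp_sum, ← Finset.sum_mul, Real.exp_le_exp]
    refine mul_le_mul_of_nonneg_right (htail _ hsub ?_).le (norm_nonneg _)
    exact Finset.sdiff_disjoint.mono_right Finset.subset_union_left
  calc _ ≤ Real.exp (ε / 2 * ‖z‖) * (C * Real.exp (ε / 2 * ‖z‖)) :=
        mul_le_mul h1 (hC z) (norm_nonneg _) (Real.exp_pos _).le
    _ = C * Real.exp (ε * ‖z‖) := by
        rw [mul_left_comm, ← Real.exp_add]; ring_nf

end IsCanonicalLimit

theorem exp_le_norm_cexponential_sq (z : ℂ) :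
    Real.exp (2 * |z.im|) ≤ ‖cexponential z‖ ^ 2 := by
  have hpi := Real.pi_gt_three
  have gen : ∀ α : ℝ, -3 ≤ α → α ≤ 2 → (∀ t ∈ Set.Ioo α (α + 1), |z.im| ≤ -(z.im * t)) →
      Real.exp (2 * |z.im|) ≤ ‖cexponential z‖ ^ 2 := by
    intro α hα1 hα2 hα
    have hint : Integrable (fun t => ‖cexponential z t‖ ^ 2)
        (volume.restrict (Set.Ioo (-Real.pi) Real.pi)) :=
      (memLp_two_iff_integrable_sq_norm (Lp.memLp _).1).1 (Lp.memLp _)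
    have hsub : Set.Ioo α (α + 1) ⊆ Set.Ioo (-Real.pi) Real.pi :=
      Set.Ioo_subset_Ioo (by linarith) (by linarith)
    rw [L2pi.norm_sq_eq_integral]
    have h1 : ∫ t in Set.Ioo α (α + 1), ‖cexponential z t‖ ^ 2 ≤
        ∫ t in Set.Ioo (-Real.pi) Real.pi, ‖cexponential z t‖ ^ 2 :=
      setIntegral_mono_set hint (Eventually.of_forall fun _ => by positivity)
        hsub.eventuallyLE
    refine le_trans ?_ h1
    have h2 : ∫ _ in Set.Ioo α (α + 1), Real.exp (2 * |z.im|) = Real.exp (2 * |z.im|) := by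
      simp
    rw [← h2]
    refine integral_mono_ae (integrable_const _)
      (hint.mono_measure (Measure.restrict_mono hsub le_rfl)) ?_
    filter_upwards [ae_restrict_mem measurableSet_Ioo,
      ae_restrict_of_ae_restrict_of_subset hsub (coeFn_cexponential z)] with t ht hzt
    rw [hzt, Complex.norm_exp, ← Real.exp_nat_mul, Real.exp_le_exp]
    have h3 : (Complex.I * z * t).re = -(z.im * t) := by simp
    rw [h3]
    push_cast
    linarith [hα t ht]
  rcases le_total 0 z.im with h | h
  · refine gen (-2) (by norm_num) (by norm_num) fun t ht => ?_
    rw [abs_of_nonneg h]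
    nlinarith [ht.2]
  · refine gen 1 (by norm_num) (by norm_num) fun t ht => ?_
    rw [abs_of_nonpos h]
    nlinarith [ht.1]

/-- The frequencies of a Riesz basis of exponentials have summable inverse squares. -/
theorem IsRieszDual.summable_recipSq {Z : Set ℝ} {U : ℝ → L2pi}
    (hU : IsRieszDual (fun a : Z => exponential a) (fun a : Z => U a))
    (hfin : {a ∈ Z | |a| < 1}.Finite) : Summable fun a : Z => recipSq a := by
  have hs := hU.summable_left (cexponential (-Complex.I))
  obtain ⟨s, hsdef⟩ : ∃ s : ℝ, s = (Real.exp Real.pi - Real.exp (-Real.pi)) / 2 := ⟨_, rfl⟩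
  have hspos : 0 < s := by
    have : Real.exp (-Real.pi) < Real.exp Real.pi :=
      Real.exp_lt_exp.2 (by linarith [Real.pi_pos])
    rw [hsdef]; linarith
  have hsin : ∀ a : ℝ, s ≤ ‖Complex.sin ((-Complex.I - a) * Real.pi)‖ := by
    intro a
    rw [Complex.sin, norm_div, norm_mul, Complex.norm_I, mul_one, Complex.norm_ofNat, hsdef]
    refine div_le_div_of_nonneg_right ?_ two_pos.le
    rw [norm_sub_rev]
    refine le_trans (le_of_eq ?_) (norm_sub_norm_le _ _)
    rw [Complex.norm_exp, Complex.norm_exp]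
    congr 2 <;> simp
  refine Summable.of_norm_bounded_eventually (hs.mul_left (2 / (4 * s ^ 2))) ?_
  rw [eventually_cofinite]
  refine Set.Finite.subset (hfin.preimage Subtype.val_injective.injOn) fun a ha => ?_
  refine ⟨a.2, ?_⟩
  by_contra hlt
  refine ha ?_
  have ha1 : 1 ≤ |(a : ℝ)| := not_lt.1 hlt
  have ha2 : 1 ≤ (a : ℝ) ^ 2 := by
    rw [← sq_abs]; exact one_le_pow₀ ha1
  have ha0 : (a : ℝ) ≠ 0 := by
    intro h0
    rw [h0] at ha2
    norm_num at ha2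
  have hne : ((a : ℝ) : ℂ) ≠ -Complex.I := by
    intro h0
    have := congrArg Complex.im h0
    simp at this
  have hden : ‖-Complex.I - ((a : ℝ) : ℂ)‖ ^ 2 = 1 + (a : ℝ) ^ 2 := by
    rw [Complex.sq_norm, Complex.normSq_apply]
    simp
    ring
  rw [Real.norm_of_nonneg (recipSq_nonneg _), recipSq, if_neg ha0, ← fourierEntire_ofReal,
    fourierEntire_cexponential_of_ne hne, norm_div, norm_mul, div_pow, mul_pow, hden,
    Complex.norm_ofNat]
  have h1 : s ^ 2 ≤ ‖Complex.sin ((-Complex.I - (a : ℝ)) * Real.pi)‖ ^ 2 :=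
    pow_le_pow_left₀ hspos.le (hsin a) 2
  have h2 : ((a : ℝ) ^ 2)⁻¹ ≤ 2 / (1 + (a : ℝ) ^ 2) := by
    rw [inv_le_comm₀ (by positivity) (by positivity), inv_div, div_le_iff₀ two_pos]
    linarith
  refine h2.trans ?_
  rw [← mul_div_assoc]
  refine div_le_div_of_nonneg_right ?_ (by positivity)
  rw [div_mul_eq_mul_div, le_div_iff₀ (by positivity)]
  linarith

/-- `G` is a generating function of a Riesz basis of exponentials with frequencies `Z`, expressed
through the biorthogonal system `U`; the numbers `d ζ` are the derivatives of `G` at its zeros. -/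
structure IsRieszGenerating (Z : Set ℝ) (U : ℝ → L2pi) (d : ℝ → ℂ) (G : ℂ → ℂ) : Prop where
  dual : IsRieszDual (fun a : Z => exponential a) (fun a : Z => U a)
  ne_zero : ∀ ζ ∈ Z, d ζ ≠ 0
  eq : ∀ ζ ∈ Z, ∀ z : ℂ, d ζ * ((z - ζ) * fourierEntire (U ζ) z) = G z
  nonempty : Z.Nonempty

theorem IsRieszDual.exists_isRieszGenerating {Z : Set ℝ} {U : ℝ → L2pi}
    (hU : IsRieszDual (fun a : Z => exponential a) (fun a : Z => U a)) :
    ∃ d G, IsRieszGenerating Z U d G := by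
  classical
  have hne : Z.Nonempty := by
    by_contra hemp
    have h0 : cexponential 0 = 0 := hU.isUniquenessSet _ fun a ha => (hemp ⟨a, ha⟩).elim
    have h1 := exp_le_norm_cexponential_sq 0
    rw [h0] at h1
    norm_num at h1
  obtain ⟨ζ₀, hζ₀⟩ := hne
  have h := fun ζ : Z => hU.isBiorthogonalTo.exists_ratio hU.isUniquenessSet hζ₀ ζ.2
  choose κ hκ0 hκ using h
  refine ⟨fun ζ => if hζ : ζ ∈ Z then κ ⟨ζ, hζ⟩ else 0,
    fun z => (z - ζ₀) * fourierEntire (U ζ₀) z, hU, fun ζ hζ => ?_, fun ζ hζ z => ?_, ⟨ζ₀, hζ₀⟩⟩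
  · simp only [dif_pos hζ]
    exact hκ0 _
  · simp only [dif_pos hζ]
    exact (hκ ⟨ζ, hζ⟩ z).symm

namespace IsRieszGenerating

variable {Z : Set ℝ} {U : ℝ → L2pi} {d : ℝ → ℂ} {G : ℂ → ℂ}

theorem hasDerivAt (h : IsRieszGenerating Z U d G) {ζ : ℝ} (hζ : ζ ∈ Z) :
    HasDerivAt G (d ζ) ζ := by
  have hG : G = fun z : ℂ => d ζ * ((z - ζ) * fourierEntire (U ζ) z) :=
    funext fun z => (h.eq ζ hζ z).symm
  have h1 := (((hasDerivAt_id (ζ : ℂ)).sub_const (ζ : ℂ)).mul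
    (differentiable_fourierEntire (U ζ) ζ).hasDerivAt).const_mul (d ζ)
  rw [hG]
  refine h1.congr_deriv ?_
  simp [h.dual.isBiorthogonalTo.fourierEntire_self hζ]

theorem differentiable (h : IsRieszGenerating Z U d G) : Differentiable ℂ G := by
  obtain ⟨ζ, hζ⟩ := h.nonempty
  have hG : G = fun z : ℂ => d ζ * ((z - ζ) * fourierEntire (U ζ) z) :=
    funext fun z => (h.eq ζ hζ z).symm
  have := differentiable_fourierEntire (U ζ)
  rw [hG]
  fun_prop

theorem eq_zero (h : IsRieszGenerating Z U d G) {ζ : ℝ} (hζ : ζ ∈ Z) : G ζ = 0 := by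
  rw [← h.eq ζ hζ ζ, sub_self, zero_mul, mul_zero]

theorem exists_exp_le (h : IsRieszGenerating Z U d G) : ∃ C : ℝ, 0 < C ∧ ∀ z : ℂ,
    Real.exp (2 * |z.im|) ≤ C * ∑' ζ : Z, ‖fourierEntire (U ζ) z‖ ^ 2 := by
  obtain ⟨C, hC, hle⟩ := h.dual.norm_le
  refine ⟨C, hC, fun z => ?_⟩
  have h1 := (exp_le_norm_cexponential_sq (starRingEnd ℂ z)).trans (hle _)
  rwa [Complex.conj_im, abs_neg] at h1

theorem exists_eq_of_eq_zero (h : IsRieszGenerating Z U d G) {z : ℂ} (hz : G z = 0) :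
    ∃ ζ ∈ Z, z = (ζ : ℝ) := by
  by_contra hcon
  push Not at hcon
  obtain ⟨C, -, hle⟩ := h.exists_exp_le
  have h0 : ∀ ζ : Z, fourierEntire (U ζ) z = 0 := fun ζ => by
    have h1 := h.eq ζ ζ.2 z
    rw [hz] at h1
    exact (mul_eq_zero.1 ((mul_eq_zero.1 h1).resolve_left (h.ne_zero ζ ζ.2))).resolve_left
      (sub_ne_zero.2 (hcon ζ ζ.2))
  have h1 := hle z
  simp only [h0, norm_zero, ne_eq, OfNat.ofNat_ne_zero, not_false_eq_true, zero_pow, tsum_zero,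
    mul_zero] at h1
  exact absurd h1 (not_le.2 (Real.exp_pos _))

theorem apply_I_ne_zero (h : IsRieszGenerating Z U d G) : G Complex.I ≠ 0 := by
  intro h0
  obtain ⟨ζ, -, hζ⟩ := h.exists_eq_of_eq_zero h0
  have := congrArg Complex.im hζ
  simp at this

theorem norm_eq (h : IsRieszGenerating Z U d G) {ζ : ℝ} (hζ : ζ ∈ Z) (z : ℂ) :
    ‖G z‖ = ‖d ζ‖ * (‖z - ζ‖ * ‖fourierEntire (U ζ) z‖) := by
  rw [← h.eq ζ hζ z, norm_mul, norm_mul]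

/-- A lower bound for the generating function away from its zeros. -/
theorem exists_exp_le_mul_norm (h : IsRieszGenerating Z U d G) : ∃ c : ℝ, 0 < c ∧
    ∀ (z : ℂ) (t : ℝ), 0 ≤ t → (∀ ζ ∈ Z, ‖Complex.I - (ζ : ℝ)‖ ≤ t * ‖z - (ζ : ℝ)‖) →
      c * Real.exp |z.im| ≤ t * ‖G z‖ := by
  obtain ⟨C, hC, hle⟩ := h.exists_exp_le
  have hI : 0 < ‖G Complex.I‖ := norm_pos_iff.2 h.apply_I_ne_zero
  have hsum : ∀ z : ℂ, Summable fun ζ : Z => ‖fourierEntire (U ζ) z‖ ^ 2 := fun z =>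
    h.dual.summable_right (cexponential (starRingEnd ℂ z))
  set D := ∑' ζ : Z, ‖fourierEntire (U ζ) Complex.I‖ ^ 2 with hD
  have hD0 : 0 ≤ D := tsum_nonneg fun _ => by positivity
  refine ⟨‖G Complex.I‖ / (C * D + 1), by positivity, fun z t ht hz => ?_⟩
  have h1 : ∀ ζ : Z, ‖fourierEntire (U ζ) z‖ ^ 2 * ‖G Complex.I‖ ^ 2 ≤
      (t * ‖G z‖) ^ 2 * ‖fourierEntire (U ζ) Complex.I‖ ^ 2 := by
    intro ζ
    rw [← mul_pow, ← mul_pow]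
    refine pow_le_pow_left₀ (by positivity) ?_ 2
    rw [h.norm_eq ζ.2 Complex.I, h.norm_eq ζ.2 z]
    calc _ = ‖fourierEntire (U ζ) z‖ * ‖d ζ‖ * ‖fourierEntire (U ζ) Complex.I‖ *
          ‖Complex.I - ((ζ : ℝ) : ℂ)‖ := by ring
      _ ≤ ‖fourierEntire (U ζ) z‖ * ‖d ζ‖ * ‖fourierEntire (U ζ) Complex.I‖ *
          (t * ‖z - ((ζ : ℝ) : ℂ)‖) :=
        mul_le_mul_of_nonneg_left (hz ζ ζ.2) (by positivity)
      _ = _ := by ring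
  have h2 := Summable.tsum_le_tsum h1 ((hsum z).mul_right _) ((hsum Complex.I).mul_left _)
  rw [tsum_mul_right, tsum_mul_left, ← hD] at h2
  have h3 := hle z
  have h4 : (Real.exp |z.im| * ‖G Complex.I‖) ^ 2 ≤ ((C * D + 1) * (t * ‖G z‖)) ^ 2 := by
    have h5 : Real.exp |z.im| ^ 2 = Real.exp (2 * |z.im|) := by
      rw [← Real.exp_nat_mul]; push_cast; rfl
    calc (Real.exp |z.im| * ‖G Complex.I‖) ^ 2
        = Real.exp (2 * |z.im|) * ‖G Complex.I‖ ^ 2 := by rw [mul_pow, h5]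
      _ ≤ (C * ∑' ζ : Z, ‖fourierEntire (U ζ) z‖ ^ 2) * ‖G Complex.I‖ ^ 2 := by gcongr
      _ = C * ((∑' ζ : Z, ‖fourierEntire (U ζ) z‖ ^ 2) * ‖G Complex.I‖ ^ 2) := by ring
      _ ≤ C * ((t * ‖G z‖) ^ 2 * D) := by gcongr
      _ = (C * D) * (t * ‖G z‖) ^ 2 := by ring
      _ ≤ (C * D + 1) ^ 2 * (t * ‖G z‖) ^ 2 := by
          have : 0 ≤ C * D := by positivity
          refine mul_le_mul_of_nonneg_right ?_ (by positivity)
          nlinarith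
      _ = _ := by ring
  have h6 := le_of_sq_le_sq h4 (by positivity)
  rw [div_mul_eq_mul_div, div_le_iff₀ (by positivity)]
  linarith

theorem exists_le_mul_norm (h : IsRieszGenerating Z U d G) : ∃ c : ℝ, 0 < c ∧
    ∀ ζ ∈ Z, c ≤ (1 + |ζ|) * ‖d ζ‖ := by
  have hI : 0 < ‖G Complex.I‖ := norm_pos_iff.2 h.apply_I_ne_zero
  have hsum : Summable fun ζ : Z => ‖fourierEntire (U ζ) Complex.I‖ ^ 2 :=
    h.dual.summable_right (cexponential (starRingEnd ℂ Complex.I))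
  set D := ∑' ζ : Z, ‖fourierEntire (U ζ) Complex.I‖ ^ 2 with hD
  have hD0 : 0 ≤ D := tsum_nonneg fun _ => by positivity
  refine ⟨‖G Complex.I‖ / (D + 1), by positivity, fun ζ hζ => ?_⟩
  have h1 : ‖fourierEntire (U ζ) Complex.I‖ ^ 2 ≤ D :=
    hsum.le_tsum (⟨ζ, hζ⟩ : Z) fun _ _ => by positivity
  have h2 : ‖fourierEntire (U ζ) Complex.I‖ ≤ D + 1 := by
    nlinarith [sq_nonneg (‖fourierEntire (U ζ) Complex.I‖ - 1)]
  have h3 : ‖Complex.I - ζ‖ ≤ 1 + |ζ| := by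
    refine (norm_sub_le _ _).trans ?_
    rw [Complex.norm_I, Complex.norm_real, Real.norm_eq_abs]
  rw [div_le_iff₀ (by positivity), h.norm_eq hζ]
  calc ‖d ζ‖ * (‖Complex.I - ζ‖ * ‖fourierEntire (U ζ) Complex.I‖)
      ≤ ‖d ζ‖ * ((1 + |ζ|) * (D + 1)) := by gcongr
    _ = _ := by ring

end IsRieszGenerating

/-- There are circles at a distance from the zeros that is bounded below by a power of the
radius. -/
theorem IsCanonicalLimit.exists_radius {Z : Set ℝ} {S : ℕ → Finset ℝ} {F : ℂ → ℂ}
    (h : IsCanonicalLimit Z S F) : ∃ K : ℝ, 0 < K ∧ ∀ n : ℕ, ∃ ρ : ℝ, n ≤ ρ ∧ ρ ≤ n + 1 ∧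
      ∀ ζ ∈ Z, 1 ≤ K * ((n : ℝ) + 2) ^ 2 * |ρ - (|ζ|)| := by
  set B := ∑' a : Z, recipSq a with hB
  have hB0 : 0 ≤ B := tsum_nonneg fun a => recipSq_nonneg _
  refine ⟨2 * (B + 1), by positivity, fun n => ?_⟩
  set m : ℝ := (n : ℝ) + 2 with hm
  have hm2 : 2 ≤ m := by rw [hm]; linarith [Nat.cast_nonneg (α := ℝ) n]
  set W := (h.finite m).toFinset with hW
  have hWZ : (W : Set ℝ) ⊆ Z := fun a ha => ((h.finite m).mem_toFinset.1 ha).1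
  have hcard : (W.card : ℝ) ≤ B * m ^ 2 := by
    have h1 : W.card • (m ^ 2)⁻¹ ≤ ∑ a ∈ W, recipSq a := by
      refine Finset.card_nsmul_le_sum _ _ _ fun a ha => ?_
      have ham := ((h.finite m).mem_toFinset.1 ha).2
      rw [recipSq]
      split_ifs with h0
      · exact inv_le_one_of_one_le₀ (one_le_pow₀ (by linarith))
      · have h2 : a ^ 2 ≤ m ^ 2 := by
          rw [← sq_abs]; exact pow_le_pow_left₀ (abs_nonneg _) ham.le 2
        exact inv_anti₀ (by positivity) h2
    have h2 := h1.trans (sum_le_tsum_subtype recipSq_nonneg h.summable hWZ)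
    rw [nsmul_eq_mul, ← div_eq_mul_inv, div_le_iff₀ (by positivity)] at h2
    exact h2
  set δ : ℝ := (2 * ((W.card : ℝ) + 1))⁻¹ with hδ
  have hδpos : 0 < δ := by positivity
  have hδ1 : 2 * ((W.card : ℝ) + 1) * δ = 1 := mul_inv_cancel₀ (by positivity)
  have hδK : 1 ≤ 2 * (B + 1) * m ^ 2 * δ := by
    rw [← hδ1]
    refine mul_le_mul_of_nonneg_right ?_ hδpos.le
    have : 1 ≤ m ^ 2 := one_le_pow₀ (by linarith)
    nlinarith
  suffices hex : ∃ j ∈ Finset.range (W.card + 1), ∀ ζ ∈ Z,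
      δ ≤ |(n : ℝ) + (2 * (j : ℝ) + 1) * δ - (|ζ|)| by
    obtain ⟨j, hj, hjζ⟩ := hex
    have hjc : (j : ℝ) ≤ W.card := by
      exact_mod_cast Nat.lt_succ_iff.1 (Finset.mem_range.1 hj)
    refine ⟨(n : ℝ) + (2 * (j : ℝ) + 1) * δ, ?_, ?_, fun ζ hζ => ?_⟩
    · have : 0 ≤ (2 * (j : ℝ) + 1) * δ := by positivity
      linarith
    · nlinarith
    · refine hδK.trans (mul_le_mul_of_nonneg_left (hjζ ζ hζ) (by positivity))
  by_contra hcon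
  push Not at hcon
  choose! f hfZ hf using hcon
  have hmaps : ∀ j ∈ Finset.range (W.card + 1), f j ∈ W := by
    intro j hj
    have hjc : (j : ℝ) ≤ W.card := by
      exact_mod_cast Nat.lt_succ_iff.1 (Finset.mem_range.1 hj)
    refine (h.finite m).mem_toFinset.2 ⟨hfZ j hj, ?_⟩
    have h1 := (abs_lt.1 (hf j hj)).1
    have h2 : (2 * (j : ℝ) + 1) * δ + δ ≤ 1 := by nlinarith
    rw [hm]
    linarith
  obtain ⟨j, hj, k, hk, hjk, heq⟩ :=
    Finset.exists_ne_map_eq_of_card_lt_of_maps_to (by simp) hmaps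
  have h1 := hf j hj
  have h2 := hf k hk
  rw [heq] at h1
  have h3 : |((j : ℝ) - k)| * (2 * δ) < 2 * δ := by
    have h4 : ((j : ℝ) - k) * (2 * δ) = ((n : ℝ) + (2 * (j : ℝ) + 1) * δ - |f k|) -
        ((n : ℝ) + (2 * (k : ℝ) + 1) * δ - |f k|) := by ring
    rw [← abs_of_pos (by positivity : 0 < 2 * δ), ← abs_mul, h4, abs_of_pos (by positivity : 0 < 2 * δ)]
    exact (abs_sub _ _).trans_lt (by linarith)
  have h5 : |((j : ℝ) - k)| < 1 := by
    by_contra hge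
    have : 1 * (2 * δ) ≤ |((j : ℝ) - k)| * (2 * δ) :=
      mul_le_mul_of_nonneg_right (not_lt.1 hge) (by positivity)
    linarith
  have h6 : |(j : ℤ) - k| < 1 := by exact_mod_cast h5
  rw [Int.abs_lt_one_iff, sub_eq_zero] at h6
  exact hjk (by exact_mod_cast h6)

section Comparison

variable {Z : Set ℝ} {S : ℕ → Finset ℝ} {F G : ℂ → ℂ} {U : ℝ → L2pi} {d : ℝ → ℂ}

/-- The quotient of the canonical product by a generating function has growth `o(|z|²)` in the
exponent. -/
theorem exists_quotient_norm_le (hF : IsCanonicalLimit Z S F) (hG : IsRieszGenerating Z U d G)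
    {q : ℂ → ℂ} (hq : Differentiable ℂ q) (hqF : ∀ z, F z = q z * G z) {ε : ℝ} (hε : 0 < ε) :
    ∃ C : ℝ, ∀ z, ‖q z‖ ≤ C * Real.exp (ε * ‖z‖ ^ 2) := by
  obtain ⟨K, hK, hρ⟩ := hF.exists_radius
  obtain ⟨c, hc, hlow⟩ := hG.exists_exp_le_mul_norm
  obtain ⟨C, hC0, hC⟩ := hF.exists_norm_le (by positivity : 0 < ε / 4)
  refine ⟨C * ((1 + K) * 6) / c * Real.exp (9 * ε / 2 + 4 + 1 / (2 * ε)), fun z => ?_⟩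
  set x := ‖z‖ with hx
  have hx0 : 0 ≤ x := norm_nonneg z
  set n : ℕ := ⌈x⌉₊ + 1 with hn
  have hnx : x ≤ n := by
    rw [hn]; push_cast; linarith [Nat.le_ceil x]
  have hnx2 : (n : ℝ) ≤ x + 2 := by
    rw [hn]; push_cast; linarith [Nat.ceil_lt_add_one hx0]
  have hn1 : (1 : ℝ) ≤ n := by rw [hn]; push_cast; linarith [Nat.cast_nonneg (α := ℝ) ⌈x⌉₊]
  obtain ⟨ρ, hρ1, hρ2, hρζ⟩ := hρ n
  have hρpos : 0 < ρ := by linarith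
  have hcirc : ∀ w : ℂ, ‖w‖ = ρ →
      ‖q w‖ ≤ C * ((1 + K) * 6) / c * Real.exp (ε / 4 * (x + 3) ^ 2 + (x + 4)) := by
    intro w hw
    have hm0 : (0 : ℝ) < (n : ℝ) + 2 := by linarith
    have h1 : ∀ ζ ∈ Z, ‖Complex.I - (ζ : ℝ)‖ ≤
        ((1 + K) * ((n : ℝ) + 2) ^ 3) * ‖w - (ζ : ℝ)‖ := by
      intro ζ hζ
      have h2 : ‖Complex.I - (ζ : ℝ)‖ ≤ ‖w - (ζ : ℝ)‖ + (ρ + 1) := by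
        have h3 : Complex.I - (ζ : ℝ) = (w - (ζ : ℝ)) - (w - Complex.I) := by ring
        rw [h3]
        refine (norm_sub_le _ _).trans ?_
        have := norm_sub_le w Complex.I
        rw [hw, Complex.norm_I] at this
        linarith
      have h4 : |ρ - (|ζ|)| ≤ ‖w - (ζ : ℝ)‖ := by
        have := abs_norm_sub_norm_le w (ζ : ℂ)
        rwa [hw, Complex.norm_real, Real.norm_eq_abs] at this
      have h5 : 1 ≤ K * ((n : ℝ) + 2) ^ 2 * ‖w - (ζ : ℝ)‖ :=
        (hρζ ζ hζ).trans (mul_le_mul_of_nonneg_left h4 (by positivity))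
      have h6 : ρ + 1 ≤ ((n : ℝ) + 2) * (K * ((n : ℝ) + 2) ^ 2 * ‖w - (ζ : ℝ)‖) := by
        have := mul_le_mul_of_nonneg_left h5 hm0.le
        linarith
      have h7 : ‖w - (ζ : ℝ)‖ ≤ ((n : ℝ) + 2) ^ 3 * ‖w - (ζ : ℝ)‖ :=
        le_mul_of_one_le_left (norm_nonneg _) (one_le_pow₀ (by linarith))
      calc _ ≤ ‖w - (ζ : ℝ)‖ + (ρ + 1) := h2
        _ ≤ ((n : ℝ) + 2) ^ 3 * ‖w - (ζ : ℝ)‖ +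
            ((n : ℝ) + 2) * (K * ((n : ℝ) + 2) ^ 2 * ‖w - (ζ : ℝ)‖) := add_le_add h7 h6
        _ = _ := by ring
    have h8 := hlow w _ (by positivity) h1
    have h9 : c ≤ (1 + K) * ((n : ℝ) + 2) ^ 3 * ‖G w‖ :=
      (le_mul_of_one_le_right hc.le (Real.one_le_exp (abs_nonneg _))).trans h8
    have hGpos : 0 < ‖G w‖ := by
      by_contra hneg
      rw [not_lt] at hneg
      have : (1 + K) * ((n : ℝ) + 2) ^ 3 * ‖G w‖ ≤ 0 :=
        mul_nonpos_of_nonneg_of_nonpos (by positivity) hneg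
      linarith
    have h10 : ((n : ℝ) + 2) ^ 3 ≤ 6 * Real.exp (x + 4) := by
      have h11 := Real.pow_div_factorial_le_exp (x + 4) (by linarith) 3
      have h12 : ((Nat.factorial 3 : ℕ) : ℝ) = 6 := by norm_num [Nat.factorial]
      rw [h12, div_le_iff₀ (by norm_num)] at h11
      have h13 : ((n : ℝ) + 2) ^ 3 ≤ (x + 4) ^ 3 := pow_le_pow_left₀ hm0.le (by linarith) 3
      linarith
    have h14 : ‖q w‖ * ‖G w‖ ≤ C * Real.exp (ε / 4 * (x + 3) ^ 2) := by
      rw [← norm_mul, ← hqF]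
      refine (hC w).trans ?_
      rw [hw]
      have : ρ ≤ x + 3 := by linarith
      gcongr
    have h15 : ‖q w‖ * c ≤ C * Real.exp (ε / 4 * (x + 3) ^ 2) *
        ((1 + K) * (6 * Real.exp (x + 4))) := by
      calc ‖q w‖ * c ≤ ‖q w‖ * ((1 + K) * ((n : ℝ) + 2) ^ 3 * ‖G w‖) := by gcongr
        _ = (‖q w‖ * ‖G w‖) * ((1 + K) * ((n : ℝ) + 2) ^ 3) := by ring
        _ ≤ _ := by gcongr
    rw [div_mul_eq_mul_div, le_div_iff₀ hc, Real.exp_add]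
    linarith
  have hmax := Complex.norm_le_of_forall_mem_frontier_norm_le (f := q) (U := Metric.ball 0 ρ)
    Metric.isBounded_ball hq.diffContOnCl (fun w hw => hcirc w (by
      rw [frontier_ball _ hρpos.ne'] at hw
      simpa using hw)) (z := z) (by
      rw [closure_ball _ hρpos.ne', mem_closedBall_zero_iff]
      linarith)
  refine hmax.trans ?_
  rw [mul_assoc, ← Real.exp_add]
  refine mul_le_mul_of_nonneg_left (Real.exp_le_exp.2 ?_) (by positivity)
  have h16 : x ≤ ε / 2 * x ^ 2 + 1 / (2 * ε) := by
    have h17 : ε / 2 * x ^ 2 + 1 / (2 * ε) - x = (ε * x - 1) ^ 2 / (2 * ε) := by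
      field_simp; ring
    have h18 : 0 ≤ (ε * x - 1) ^ 2 / (2 * ε) := by positivity
    linarith
  have h19 : ε / 4 * (x + 3) ^ 2 ≤ ε / 4 * (2 * x ^ 2 + 18) := by
    refine mul_le_mul_of_nonneg_left ?_ (by positivity)
    nlinarith [sq_nonneg (x - 3)]
  linarith

/-- The canonical product and a generating function differ by a factor `exp (p₀ + p₁ z)`. -/
theorem exists_eq_exp_mul (hF : IsCanonicalLimit Z S F) (hG : IsRieszGenerating Z U d G) :
    ∃ p₀ p₁ : ℂ, ∀ z, F z = Complex.exp (p₀ + p₁ * z) * G z := by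
  have hsimple : ∀ z, G z = 0 → F z = 0 ∧ deriv G z ≠ 0 := by
    intro z hz
    obtain ⟨ζ, hζ, rfl⟩ := hG.exists_eq_of_eq_zero hz
    exact ⟨hF.eq_zero hζ, by rw [(hG.hasDerivAt hζ).deriv]; exact hG.ne_zero ζ hζ⟩
  obtain ⟨q, hq, hqF⟩ := exists_entire_quotient hF.differentiable hG.differentiable hsimple
  have hq0 : ∀ z, q z ≠ 0 := by
    intro z h0
    have hF0 : F z = 0 := by rw [hqF, h0, zero_mul]
    have hz : ∃ a ∈ Z, z = (a : ℝ) := by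
      by_contra hcon
      push Not at hcon
      exact hF.ne_zero hcon hF0
    obtain ⟨a, ha, rfl⟩ := hz
    refine hF.deriv_ne_zero ha ?_
    have h1 : HasDerivAt F (deriv q a * G a + q a * deriv G a) a := by
      rw [show F = fun z => q z * G z from funext hqF]
      exact (hq a).hasDerivAt.mul (hG.differentiable a).hasDerivAt
    rw [h1.deriv, h0, hG.eq_zero ha]
    ring
  obtain ⟨p₀, p₁, hp⟩ := exists_eq_exp_linear hq hq0
    fun ε hε => exists_quotient_norm_le hF hG hq hqF hε
  exact ⟨p₀, p₁, fun z => by rw [hqF, hp]⟩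

/-- A bound for the derivative of the canonical product at its zeros carries over to any generating
function of the Riesz basis. -/
theorem exists_norm_le_of_deriv_le (hF : IsCanonicalLimit Z S F)
    (hG : IsRieszGenerating Z U d G) {C : ℝ} (hC : ∀ ζ : ℂ, F ζ = 0 → ‖deriv F ζ‖ ≤ C) :
    ∃ C' : ℝ, ∀ ζ ∈ Z, ‖d ζ‖ ≤ C' := by
  obtain ⟨p₀, p₁, hp⟩ := exists_eq_exp_mul hF hG
  have hbound : ∀ ζ ∈ Z, Real.exp (p₀.re + p₁.re * ζ) * ‖d ζ‖ ≤ C := by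
    intro ζ hζ
    have h1 : HasDerivAt F (deriv (fun z : ℂ => Complex.exp (p₀ + p₁ * z)) ζ * G ζ +
        Complex.exp (p₀ + p₁ * ζ) * d ζ) ζ := by
      rw [show F = fun z => Complex.exp (p₀ + p₁ * z) * G z from funext hp]
      exact HasDerivAt.mul (DifferentiableAt.hasDerivAt (by fun_prop)) (hG.hasDerivAt hζ)
    have h2 := hC ζ (hF.eq_zero hζ)
    rw [h1.deriv, hG.eq_zero hζ, mul_zero, zero_add, norm_mul, Complex.norm_exp] at h2
    simpa using h2
  suffices hre : p₁.re = 0 by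
    refine ⟨C / Real.exp p₀.re, fun ζ hζ => ?_⟩
    have := hbound ζ hζ
    rw [hre, zero_mul, add_zero] at this
    rw [le_div_iff₀ (Real.exp_pos _)]
    linarith
  by_contra hne
  set p := p₁.re with hpdef
  have hp0 : 0 < |p| := abs_pos.2 hne
  obtain ⟨c, hc, hcd⟩ := hG.exists_le_mul_norm
  set M : ℝ := 2 / |p| * (C * (1 + (|p| / 2)⁻¹) / (Real.exp p₀.re * c)) with hM
  have hside : ∀ ζ ∈ Z, 0 < p * ζ → |ζ| ≤ M := by
    intro ζ hζ hpζ
    have h1 := hbound ζ hζ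
    have h2 := hcd ζ hζ
    rw [← abs_of_pos hpζ, abs_mul] at h1
    have h3 := one_add_le_exp_mul (half_pos hp0) (abs_nonneg ζ)
    set E := Real.exp (|p| / 2 * |ζ|) with hE
    have hEE : Real.exp (p₀.re + |p| * |ζ|) = Real.exp p₀.re * (E * E) := by
      rw [hE, ← Real.exp_add, ← Real.exp_add]; ring_nf
    have hEpos : 0 < E := Real.exp_pos _
    rw [hEE] at h1
    have hd0 := norm_nonneg (d ζ)
    have h4 : c ≤ (1 + (|p| / 2)⁻¹) * E * ‖d ζ‖ :=
      h2.trans (mul_le_mul_of_nonneg_right h3 hd0)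
    have h5 : Real.exp p₀.re * c * E ≤ C * (1 + (|p| / 2)⁻¹) := by
      calc Real.exp p₀.re * c * E
          ≤ Real.exp p₀.re * ((1 + (|p| / 2)⁻¹) * E * ‖d ζ‖) * E := by gcongr
        _ = (Real.exp p₀.re * (E * E) * ‖d ζ‖) * (1 + (|p| / 2)⁻¹) := by ring
        _ ≤ _ := by gcongr
    have h6 : |p| / 2 * |ζ| ≤ E := by linarith [Real.add_one_le_exp (|p| / 2 * |ζ|)]
    have hec : 0 < Real.exp p₀.re * c := mul_pos (Real.exp_pos _) hc
    have h7 : |p| / 2 * |ζ| ≤ C * (1 + (|p| / 2)⁻¹) / (Real.exp p₀.re * c) := by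
      rw [le_div_iff₀ hec]
      calc _ ≤ E * (Real.exp p₀.re * c) := by gcongr
        _ ≤ _ := by linarith
    rw [hM]
    calc |ζ| = 2 / |p| * (|p| / 2 * |ζ|) := by field_simp
      _ ≤ _ := by gcongr
  set T₀ := (hF.finite (M + 1)).toFinset with hT₀
  have hσ : ∀ a ∈ Z, a ∉ T₀ → (-(p / |p|)) * a⁻¹ = |a|⁻¹ := by
    intro a ha haT
    have h1 : M + 1 ≤ |a| := by
      by_contra hlt
      exact haT ((hF.finite _).mem_toFinset.2 ⟨ha, not_le.1 hlt⟩)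
    have h2 : p * a ≤ 0 := by
      by_contra hpos
      linarith [hside a ha (not_le.1 hpos)]
    rcases eq_or_ne a 0 with rfl | ha0
    · simp
    have h3 : |p| * |a| = -(p * a) := by rw [← abs_mul, abs_of_nonpos h2]
    have h4 : |a| = -(p * a) / |p| := by
      rw [eq_div_iff hp0.ne']
      linarith
    rw [h4]
    field_simp
    rw [sq_abs]
  obtain ⟨C₀, hC₀, hF₀⟩ := hF.exists_norm_le_of_one_sided hσ
    (by rw [abs_neg, abs_div, abs_abs, div_self hp0.ne'])
    (fun a ha => ((hF.finite _).mem_toFinset.1 ha).1) (by norm_num : (0 : ℝ) < 1 / 4)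
  obtain ⟨c', hc', hlow⟩ := hG.exists_exp_le_mul_norm
  have hGlow : ∀ z : ℂ, z.re = 0 → 1 ≤ |z.im| → c' * Real.exp |z.im| ≤ ‖G z‖ := by
    intro z hz hz1
    have := hlow z 1 zero_le_one fun ζ _ => by
      rw [one_mul]
      refine le_of_sq_le_sq ?_ (norm_nonneg _)
      rw [Complex.sq_norm, Complex.sq_norm, Complex.normSq_apply, Complex.normSq_apply]
      have h1 : 1 ≤ z.im * z.im := by
        rw [← abs_mul_abs_self]; nlinarith
      simp only [Complex.sub_re, Complex.I_re, Complex.ofReal_re, Complex.sub_im, Complex.I_im,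
        Complex.ofReal_im, hz]
      linarith
    rwa [one_mul] at this
  have hy : ∀ y : ℝ, 1 ≤ y → (Real.exp p₀.re * c') ^ 2 * Real.exp (3 / 2 * y) ≤ C₀ ^ 2 := by
    intro y hy1
    have hyabs : |y| = y := abs_of_nonneg (by linarith)
    have hnorm : ‖(y : ℂ) * Complex.I‖ = y := by
      rw [norm_mul, Complex.norm_I, mul_one, Complex.norm_real, Real.norm_eq_abs, hyabs]
    have g1 := hGlow (y * Complex.I) (by simp) (by simp [hyabs, hy1])
    have g2 := hGlow (-(y * Complex.I)) (by simp) (by simp [hyabs, hy1])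
    have f1 := hF₀ (y * Complex.I)
    have f2 := hF₀ (-(y * Complex.I))
    rw [hp, norm_mul, Complex.norm_exp] at f1 f2
    rw [norm_neg] at f2
    rw [hnorm] at f1 f2
    simp only [Complex.mul_im, Complex.neg_im, Complex.ofReal_re, Complex.I_im, mul_one,
      Complex.ofReal_im, Complex.I_re, mul_zero, add_zero, abs_neg, hyabs] at g1 g2
    have f3 := mul_le_mul f1 f2 (by positivity) (by positivity)
    set e₁ := Real.exp (p₀ + p₁ * (y * Complex.I)).re with he₁
    set e₂ := Real.exp (p₀ + p₁ * -(y * Complex.I)).re with he₂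
    have hee : e₁ * e₂ = Real.exp p₀.re ^ 2 := by
      rw [he₁, he₂, ← Real.exp_add, ← Real.exp_nat_mul]
      congr 1
      simp
      ring
    have g3 := mul_le_mul g1 g2 (by positivity) (norm_nonneg _)
    have hE4 : Real.exp (1 / 4 * y) * Real.exp (1 / 4 * y) = Real.exp (y / 2) := by
      rw [← Real.exp_add]; ring_nf
    have hEy : Real.exp y * Real.exp y = Real.exp (3 / 2 * y) * Real.exp (y / 2) := by
      rw [← Real.exp_add, ← Real.exp_add]; ring_nf
    refine le_of_mul_le_mul_right ?_ (Real.exp_pos (y / 2))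
    calc (Real.exp p₀.re * c') ^ 2 * Real.exp (3 / 2 * y) * Real.exp (y / 2)
        = Real.exp p₀.re ^ 2 * (c' * Real.exp y * (c' * Real.exp y)) := by
          linear_combination (-1 : ℝ) * (Real.exp p₀.re * c') ^ 2 * hEy
      _ ≤ Real.exp p₀.re ^ 2 * (‖G (y * Complex.I)‖ * ‖G (-(y * Complex.I))‖) := by gcongr
      _ = (e₁ * ‖G (y * Complex.I)‖) * (e₂ * ‖G (-(y * Complex.I))‖) := by
          rw [← hee]; ring
      _ ≤ (C₀ * Real.exp (1 / 4 * y)) * (C₀ * Real.exp (1 / 4 * y)) := f3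
      _ = C₀ ^ 2 * Real.exp (y / 2) := by rw [← hE4]; ring
  set Q := (Real.exp p₀.re * c') ^ 2 with hQ
  have hQ0 : 0 < Q := by positivity
  set y : ℝ := 1 + C₀ ^ 2 / Q with hydef
  have hy1 : 1 ≤ y := by
    have : 0 ≤ C₀ ^ 2 / Q := by positivity
    linarith
  have h1 := hy y hy1
  have h2 : y < Real.exp (3 / 2 * y) := by linarith [Real.add_one_le_exp (3 / 2 * y)]
  have h3 : Q * y < C₀ ^ 2 := (mul_lt_mul_of_pos_left h2 hQ0).trans_le h1
  have h4 : Q * y = Q + C₀ ^ 2 := by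
    rw [hydef]; field_simp
  linarith

end Comparison

theorem isCompleteSystem_mixedSystem_of_isGeneratingFunction {Λ Λ₁ Z : Set ℝ} {w : ℝ → L2pi}
    (hΛ : IsUniquenessSet Λ) (hw : IsBiorthogonalTo Λ w) (hZ : Λ₁ ⊆ Z)
    (hriesz : IsRieszBasis (fun a : Z => exponential a)) {F : ℂ → ℂ}
    (hF : IsGeneratingFunction Z F) {C : ℝ} (hC : ∀ ζ : ℂ, F ζ = 0 → ‖deriv F ζ‖ ≤ C) :
    IsCompleteSystem (mixedSystem Λ Λ₁ w) := by
  obtain ⟨U, hU⟩ := hriesz.exists_dual_exponential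
  obtain ⟨S, hS⟩ := hF.exists_isCanonicalLimit (hU.summable_recipSq (hF.1 1))
  obtain ⟨d, G, hG⟩ := hU.exists_isRieszGenerating
  obtain ⟨C', hC'⟩ := exists_norm_le_of_deriv_le hS hG hC
  exact isCompleteSystem_mixedSystem_of_bounded hΛ hw hZ hU hC' hG.ne_zero
    (Φ := fun x => G x) fun ζ hζ x => hG.eq ζ hζ x

theorem theorem4p1 (Λ Λ₁ : Set ℝ)
    (hcomplete : IsCompleteSystem (exponential '' Λ))
    (hminimal : IsMinimalSystem (fun a : Λ => exponential a))
    (hsub : Λ₁ ⊆ Λ)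
    (w : ℝ → L2pi) (hw : IsBiorthogonalTo Λ w) :
    ((∃ (Λ₂' : Set ℝ) (F : ℂ → ℂ),
        IsRieszBasis (fun a : ↥(Λ₁ ∪ Λ₂') => exponential a) ∧
        IsGeneratingFunction (Λ₁ ∪ Λ₂') F ∧
        ∃ C : ℝ, ∀ ζ : ℂ, F ζ = 0 → ‖deriv F ζ‖ ≤ C) →
      IsCompleteSystem (mixedSystem Λ Λ₁ w)) ∧
    (¬ IsCompleteSystem (mixedSystem Λ Λ₁ w) →
      ¬ Λ₁ ⊆ Set.range (fun n : ℤ => (n : ℝ))) := by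
  refine ⟨?_, fun hnot hint => hnot
    (isCompleteSystem_mixedSystem_of_subset_int hcomplete.isUniquenessSet hw hint)⟩
  rintro ⟨Λ₂', F, hriesz, hF, C, hC⟩
  exact isCompleteSystem_mixedSystem_of_isGeneratingFunction hcomplete.isUniquenessSet hw
    Set.subset_union_left hriesz hF hC
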